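/- Consider a loss network with $s$ resources of capacities $b_k\ge 0$ ($k=1,\dots,s$) and $m$ request classes. Class $i$ requests arrive according to independent Poisson processes of rate $\lambda_i>0$, have independent $\exp(\mu_i)$ service times, $\mu_i>0$, pay $r_i\ge 0$ per unit of time in service, and accept any of the allocations $\mathbf b_{i1},\dots,\mathbf b_{il_i}\in\mathbf R_+^s$. Let $\rho_i=\lambda_i/\mu_i$. Let $0<\varepsilon<\frac14$ and let $\boldsymbol\alpha^\varepsilon=(\alpha^\varepsilon_{ij})$ be an optimal solution of the linear program: maximize $\sum_i r_i\rho_i\sum_j\alpha_{ij}$ subject to $\sum_i\rho_i\sum_j b_{ij}(k)\alpha_{ij}\le\frac{1}{1+4\varepsilon}b_k$ for all $k$, $\sum_j\alpha_{ij}\le1$ for all $i$, and $\alpha_{ij}\ge0$. Write $\alpha_i^\varepsilon=\sum_j\alpha_{ij}^\varepsilon$ and put $$c_i^1=(1+4\varepsilon)(1-\alpha_i^\varepsilon)\rho_i,\qquad c_{ik}^0=(1+4\varepsilon)\,\nu_k\Big(\sum_j\alpha_{ij}^\varepsilon b_{ij}(k)\Big)\rho_i,\qquad \nu_k=\frac{\frac{1}{1+4\varepsilon}b_k}{\sum_{i}\sum_j\alpha^\varepsilon_{ij}\rho_i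 b_{ij}(k)}$$ (with $c^0_{ik}=0$ for all $i$ if the denominator of $\nu_k$ vanishes). Let $\beta>0$ satisfy $\beta\le\varepsilon\, c_{ik}^0/b_{ij}(k)$ for all $i,j,k$ with $b_{ij}(k)>0$, and $\beta\le\varepsilon\, c_i^1$ for all $i$ with $\alpha_i^\varepsilon<1$. The penalty policy $\bar\pi$ adds to the network a fictitious system of infinite capacity. Let $\bar x_{ij}(t)$ be the number of class $i$ requests in the network at time $t$ that are assigned to $\mathbf b_{ij}$, and $\bar y_i(t)$ the number of class $i$ requests in the fictitious system. Put $\Psi_{ik}(\mathbf x_i)=\exp\big(\beta\sum_j x_{ij}b_{ij}(k)/c_{ik}^0\big)$ (equal to $1$ if $b_{ij}(k)=0$ for all $j$) and $\Psi_i(y_i)=\exp(\beta y_i/c_i^1)$. A class $i$ arrival is conditionally accepted if $\min_j\sum_k\partial\Psi_{ik}/\partial x_{ij}\le\partial\Psi_i/\partial y_i$ at the current state (the right-hand side being $+\infty$ if $c_i^1=0$). A conditionally accepted request is assigned to a $\mathbf b_{ij}$ with $j$ attaining this minimum if that allocation fits into the free capacity, that is, $\sum_{i',j'}\mathbf b_{i'j'}\bar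 x_{i'j'}+\mathbf b_{ij}\le\mathbf b$; ties between minimizers are broken by any fixed function of the state. All other requests go to the fictitious system, where class $i$ requests also have independent $\exp(\mu_i)$ service times. Initially the network is empty and the fictitious system holds $\bar y_i(0^-)=(1-\alpha_i^\varepsilon)\rho_i$ requests of class $i$ (these numbers being integers). Then for every $t\ge0$ the reward rate $\bar R(t)=\sum_i r_i\sum_j\bar x_{ij}(t)$ is integrable and satisfies $$\mathbf E[\bar R(t)]\ \ge\ \sum_{i=1}^m\alpha_i^\varepsilon r_i\rho_i(1-e^{-\mu_it})-\zeta\sum_{i=1}^m(1-\alpha_i^\varepsilon)r_i\rho_i-(s+1)^2e^{-\frac{\varepsilon}{2}(\beta-4)}\sum_{i=1}^m r_i\rho_i(1-e^{-\mu_it}),$$ where $\zeta=\Big(\frac{\log(s+1)}{\beta}+1-\frac{\varepsilon}{2}\Big)(1+4\varepsilon)-1$. -/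

import Mathlib

open MeasureTheory ProbabilityTheory Filter Topology
open scoped NNReal

noncomputable section

/-- The data of a loss network with `s` resources and `m` request classes. Class `i` requests arrive
at rate `arrivalRate i`, stay for an exponential time of rate `serviceRate i`, pay `reward i` per
unit time while in the network, and accept any of `numAlloc i` alternative capacity allocations, the
`j`-th of which occupies `alloc i j k` units of resource `k`. -/
structure LossNetwork (m s : ℕ) where
  capacity : Fin s → ℝ
  numAlloc : Fin m → ℕ
  alloc : (i : Fin m) → Fin (numAlloc i) → Fin s → ℝ
  arrivalRate : Fin m → ℝ
  serviceRate : Fin m → ℝ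
  reward : Fin m → ℝ
  capacity_nonneg : ∀ k, 0 ≤ capacity k
  alloc_nonneg : ∀ i j k, 0 ≤ alloc i j k
  arrivalRate_pos : ∀ i, 0 < arrivalRate i
  serviceRate_pos : ∀ i, 0 < serviceRate i
  reward_nonneg : ∀ i, 0 ≤ reward i

namespace LossNetwork

variable {m s : ℕ} (L : LossNetwork m s)

/-- The offered load of class `i`. -/
def load (i : Fin m) : ℝ := L.arrivalRate i / L.serviceRate i

/-! ### The perturbed steady-state linear program -/

/-- Fractions `α i j` of the class `i` load, one for each class and each of its allocations. -/
abbrev Fractions : Type := (i : Fin m) → Fin (L.numAlloc i) → ℝ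

/-- Feasibility for the steady-state linear program with capacities divided by `1 + 4 ε`. -/
structure IsFeasible (ε : ℝ) (α : L.Fractions) : Prop where
  capacity_le : ∀ k, ∑ i, L.load i * ∑ j, L.alloc i j k * α i j ≤ 1 / (1 + 4 * ε) * L.capacity k
  sum_le_one : ∀ i, ∑ j, α i j ≤ 1
  nonneg : ∀ i j, 0 ≤ α i j

/-- The objective of the linear program. -/
def lpObjective (α : L.Fractions) : ℝ := ∑ i, L.reward i * L.load i * ∑ j, α i j

/-- `α` is an optimal solution of the perturbed linear program. -/
def IsOptimal (ε : ℝ) (α : L.Fractions) : Prop :=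
  L.IsFeasible ε α ∧ ∀ α' : L.Fractions, L.IsFeasible ε α' → L.lpObjective α' ≤ L.lpObjective α

/-! ### The target capacities of the penalty function -/

/-- The capacity of the fictitious system for class `i`. -/
def fictCapacity (ε : ℝ) (α : L.Fractions) (i : Fin m) : ℝ :=
  (1 + 4 * ε) * (1 - ∑ j, α i j) * L.load i

/-- The factor by which the usage of resource `k` under `α` can be scaled up until it reaches the
perturbed capacity. For a resource that `α` does not use at all its value plays no role, because
the capacities `resCapacity` of that resource vanish whatever the factor is. -/
def slack (ε : ℝ) (α : L.Fractions) (k : Fin s) : ℝ :=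
  (1 / (1 + 4 * ε) * L.capacity k) / ∑ i, ∑ j, α i j * L.load i * L.alloc i j k

/-- The share of resource `k` that is meant for class `i`. -/
def resCapacity (ε : ℝ) (α : L.Fractions) (i : Fin m) (k : Fin s) : ℝ :=
  (1 + 4 * ε) * L.slack ε α k * (∑ j, α i j * L.alloc i j k) * L.load i

/-- The upper bound on the multiplier `β`: it is at most `ε` times each ratio
`resCapacity i k / alloc i j k` (a ratio with denominator zero is infinite, hence no restriction)
and at most `ε` times `fictCapacity i` for each class `i` that is not fully admitted by `α`. -/
structure IsAdmissible (ε : ℝ) (α : L.Fractions) (β : ℝ) : Prop where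
  le_res : ∀ i j k, 0 < L.alloc i j k → β ≤ ε * (L.resCapacity ε α i k / L.alloc i j k)
  le_fict : ∀ i, ∑ j, α i j < 1 → β ≤ ε * L.fictCapacity ε α i

/-! ### The penalty function and its partial derivatives -/

/-- The penalty of class `i` at resource `k`, as a function of the numbers `x j` of class `i`
requests assigned to the different allocations. If `alloc i j k = 0` for all `j`, it is the
constant `1`. -/
def resPenalty (ε : ℝ) (α : L.Fractions) (β : ℝ) (i : Fin m) (k : Fin s)
    (x : Fin (L.numAlloc i) → ℝ) : ℝ :=
  Real.exp (β * ((∑ j, x j * L.alloc i j k) / L.resCapacity ε α i k))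

/-- The penalty of class `i` in the fictitious system (used only if `fictCapacity i ≠ 0`). -/
def fictPenalty (ε : ℝ) (α : L.Fractions) (β : ℝ) (i : Fin m) (y : ℝ) : ℝ :=
  Real.exp (β * (y / L.fictCapacity ε α i))

/-- The sum over all resources `k` of the partial derivatives of `resPenalty i k` with respect to
the number of requests assigned to allocation `j`. -/
def resMarginal (ε : ℝ) (α : L.Fractions) (β : ℝ) (i : Fin m)
    (x : Fin (L.numAlloc i) → ℝ) (j : Fin (L.numAlloc i)) : ℝ :=
  ∑ k, deriv (fun u : ℝ => L.resPenalty ε α β i k (Function.update x j u)) (x j)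

/-- The derivative of `fictPenalty i`. For a class with `fictCapacity i = 0` it is `+∞`, the limit
as the capacity decreases to zero. -/
def fictMarginal (ε : ℝ) (α : L.Fractions) (β : ℝ) (i : Fin m) (y : ℝ) : EReal :=
  if L.fictCapacity ε α i = 0 then ⊤ else ((deriv (L.fictPenalty ε α β i) y : ℝ) : EReal)

/-! ### The penalty policy -/

/-- States of the augmented network: `st.1 i j` is the number of class `i` requests in the network
that are assigned to their allocation `j`, and `st.2 i` is the number of class `i` requests in the
fictitious system. -/
abbrev State : Type := ((i : Fin m) → Fin (L.numAlloc i) → ℕ) × (Fin m → ℕ)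

/-- There is adequate capacity for one more class `i` request with allocation `j`. -/
def Fits (st : L.State) (i : Fin m) (j : Fin (L.numAlloc i)) : Prop :=
  ∀ k, ∑ i', ∑ j', L.alloc i' j' k * (st.1 i' j' : ℝ) + L.alloc i j k ≤ L.capacity k

/-- `j` minimises the marginal penalty among the allocations of class `i`. -/
def IsCheapest (ε : ℝ) (α : L.Fractions) (β : ℝ) (st : L.State) (i : Fin m)
    (j : Fin (L.numAlloc i)) : Prop :=
  ∀ j', L.resMarginal ε α β i (fun a => (st.1 i a : ℝ)) j ≤
    L.resMarginal ε α β i (fun a => (st.1 i a : ℝ)) j'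

/-- A class `i` request that arrives in state `st` is conditionally accepted: the smallest marginal
penalty of its allocations is at most the marginal penalty of the fictitious system. -/
def CondAccepted (ε : ℝ) (α : L.Fractions) (β : ℝ) (st : L.State) (i : Fin m) : Prop :=
  ∃ j, ((L.resMarginal ε α β i (fun a => (st.1 i a : ℝ)) j : ℝ) : EReal) ≤
    L.fictMarginal ε α β i (st.2 i : ℝ)

/-- A routing rule: where a class `i` request goes that finds the state `st` on arrival, `some j`
for allocation `j` and `none` for the fictitious system. -/
abbrev Rule : Type := (i : Fin m) → L.State → Option (Fin (L.numAlloc i))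

/-- `d` is a penalty rule: a conditionally accepted request selects an allocation of least marginal
penalty and is assigned to it if there is adequate capacity; every other request goes to the
fictitious system. Ties between allocations of least marginal penalty may be broken in any way
(with or without regard to which of them fit). -/
structure IsPenaltyRule (ε : ℝ) (α : L.Fractions) (β : ℝ) (d : L.Rule) : Prop where
  accept : ∀ i st j, d i st = some j →
    L.CondAccepted ε α β st i ∧ L.IsCheapest ε α β st i j ∧ L.Fits st i j
  reject : ∀ i st, d i st = none → L.CondAccepted ε α β st i →
    ∃ j, L.IsCheapest ε α β st i j ∧ ¬ L.Fits st i j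

/-! ### The state process -/

/-- `st` with one more class `i` request at allocation `j`. -/
def State.addReq {L : LossNetwork m s} (st : L.State) (i : Fin m) (j : Fin (L.numAlloc i)) :
    L.State :=
  (Function.update st.1 i (Function.update (st.1 i) j (st.1 i j + 1)), st.2)

/-- `st` with one class `i` request less at allocation `j` (only used if there is one). -/
def State.removeReq {L : LossNetwork m s} (st : L.State) (i : Fin m) (j : Fin (L.numAlloc i)) :
    L.State :=
  (Function.update st.1 i (Function.update (st.1 i) j (st.1 i j - 1)), st.2)

/-- `st` with one more class `i` request in the fictitious system. -/
def State.addFict {L : LossNetwork m s} (st : L.State) (i : Fin m) : L.State :=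
  (st.1, Function.update st.2 i (st.2 i + 1))

/-- `st` with one class `i` request less in the fictitious system (only used if there is one). -/
def State.removeFict {L : LossNetwork m s} (st : L.State) (i : Fin m) : L.State :=
  (st.1, Function.update st.2 i (st.2 i - 1))

/-- The state right after a class `i` request has arrived in state `st` and was routed by `d`. -/
def afterArrival (d : L.Rule) (i : Fin m) (st : L.State) : L.State :=
  match d i st with
  | some j => st.addReq i j
  | none => st.addFict i

/-- The generator of the augmented network under the rule `d`: class `i` requests arrive at rate
`arrivalRate i` and are routed by `d`; each class `i` request, in the network or in the fictitious
system, departs at rate `serviceRate i`, independently of everything else. -/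
def generator (d : L.Rule) (f : L.State → ℝ) (st : L.State) : ℝ :=
  ∑ i, L.arrivalRate i * (f (L.afterArrival d i st) - f st)
  + ∑ i, ∑ j, L.serviceRate i * (st.1 i j : ℝ) * (f (st.removeReq i j) - f st)
  + ∑ i, L.serviceRate i * (st.2 i : ℝ) * (f (st.removeFict i) - f st)

/-- `S` is the state process of the augmented network under the rule `d` when the network is
initially empty and the fictitious system initially holds `y₀ i` requests of class `i`: the
continuous-time Markov chain, relative to the filtration `ℱ`, with the above generator, as the
solution with piecewise constant, right-continuous paths of the martingale problem for finitely
supported test functions. -/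
structure IsStateChain (d : L.Rule) (y₀ : Fin m → ℕ) {Ω : Type*} [mΩ : MeasurableSpace Ω]
    (P : Measure Ω) (ℱ : Filtration ℝ≥0 mΩ) (S : ℝ≥0 → Ω → L.State) : Prop where
  adapted : ∀ t, Measurable[ℱ t] (S t)
  right_cont : ∀ ω t, ∀ᶠ u in 𝓝[≥] t, S u ω = S t ω
  left_lim : ∀ ω t, ∃ st, ∀ᶠ u in 𝓝[<] t, S u ω = st
  initial : ∀ᵐ ω ∂P, S 0 ω = (fun _ _ => 0, y₀)
  martingale : ∀ f : L.State → ℝ, f.support.Finite →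
    Martingale (fun (t : ℝ≥0) ω =>
      f (S t ω) - ∫ u in (0 : ℝ)..(t : ℝ), L.generator d f (S u.toNNReal ω)) ℱ P

/-- The instantaneous reward rate in state `st`. -/
def rewardRate (st : L.State) : ℝ := ∑ i, L.reward i * ∑ j, (st.1 i j : ℝ)

end LossNetwork

end

open MeasureTheory ProbabilityTheory Filter Topology
open scoped NNReal

noncomputable section

namespace LossNetwork

variable {m s : ℕ} {L : LossNetwork m s}

/-! The routing does not affect the total number of class `i` requests, in the network and in the
fictitious system together. This total is an M/M/∞ queue started at `(1 - α_i) ρ_i`, with mean `ρ_i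
- α_i ρ_i e^{-μ_i t}`. The reward rate is `∑ r_i (total_i - y_i)`, so it suffices to bound `E y_i`
from above by `fictLevel` plus `δ ρ_i (1 - e^{-μ_i t})`, where `δ = (s+1)² e^{-ε(β-4)/2}`; this is
`IsTarget.integral_snd_le`.

The excess of `y_i` over `fictLevel` drains at rate at least `μ_i`. It is fed only by requests sent
to the fictitious system when `y_i` is within one of that level. Such a request either found the
network too expensive or did not fit. The indicator of this event is dominated by exponential
Lyapunov functions of small mean.

Write `a = α_i`, `η = β / ((1+4ε) ρ_i)`, `F` for `resSum`, `w` for `fictWeight`. The key function is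
the weighted geometric mean `G = F^a e^{(1-a) w y}` (`mixed`). A class `i` arrival multiplies `G` by
at most `1 + (1+ε) η` wherever it goes: on the fictitious side because `(1-a) w ≤ η`, on the network
side because the cheapest marginal penalty is at most the `α`-average, so that `a` times it is at
most `η F`. Departures contribute about `-G log G`. The tangent inequality for `x log x` turns the
balance into a drift of at most `μ_i (1-ε/2)(C - G)` with `C = (s+1)^a e^{β(1-ε)}`, so `E G ≤ C` at
all times (`IsTarget.generator_mixed_le`). The factor `1 + 4ε` in the capacities pays for the
linearisation errors.

The acceptance test then controls each side by `G`. An admitted request has marginal penalty at most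
`2ηG`, whence `E F ≤ 2(s+1) e^{β(1-ε)}`. A refused one has found `e^{wy} ≤ 2G`, although near
`fictLevel` the left side is of order `(s+1) e^{β(1-ε/2)}`. A request that does not fit meets a
resource whose exponents average at least `β - ε`, and Jensen's inequality makes a weighted sum of
the `F`'s at least `e^{β-ε}`.

The chain is specified by finitely supported test functions only. A Poisson-type tail bound
(`IsStateChain.tail_le`) gives all exponential moments, and truncation extends Dynkin's formula to
the functions above (`IsStateChain.dynkin`). -/

/-! ### Counting requests -/

/-- The number of class `i` requests, in the network or in the fictitious system. -/
def State.classTotal (st : L.State) (i : Fin m) : ℕ := (∑ j, st.1 i j) + st.2 i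

/-- The number of all requests, in the network or in the fictitious system. -/
def State.total (st : L.State) : ℕ := ∑ i, st.classTotal i

lemma State.addReq_fst_self (st : L.State) (i : Fin m) (j : Fin (L.numAlloc i)) :
    (st.addReq i j).1 i = Function.update (st.1 i) j (st.1 i j + 1) := by
  simp [State.addReq]

lemma State.removeReq_fst_self (st : L.State) (i : Fin m) (j : Fin (L.numAlloc i)) :
    (st.removeReq i j).1 i = Function.update (st.1 i) j (st.1 i j - 1) := by
  simp [State.removeReq]

lemma State.addReq_fst_of_ne (st : L.State) {i i' : Fin m} (h : i' ≠ i)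
    (j : Fin (L.numAlloc i)) : (st.addReq i j).1 i' = st.1 i' := by
  simp [State.addReq, h]

lemma State.removeReq_fst_of_ne (st : L.State) {i i' : Fin m} (h : i' ≠ i)
    (j : Fin (L.numAlloc i)) : (st.removeReq i j).1 i' = st.1 i' := by
  simp [State.removeReq, h]

lemma State.addFict_snd_self (st : L.State) (i : Fin m) :
    (st.addFict i).2 i = st.2 i + 1 := by
  simp [State.addFict]

lemma State.removeFict_snd_self (st : L.State) (i : Fin m) :
    (st.removeFict i).2 i = st.2 i - 1 := by
  simp [State.removeFict]

lemma State.addFict_snd_of_ne (st : L.State) {i i' : Fin m} (h : i' ≠ i) :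
    (st.addFict i).2 i' = st.2 i' := by
  simp [State.addFict, h]

lemma State.removeFict_snd_of_ne (st : L.State) {i i' : Fin m} (h : i' ≠ i) :
    (st.removeFict i).2 i' = st.2 i' := by
  simp [State.removeFict, h]

lemma sum_update_succ {ι : Type*} [Fintype ι] [DecidableEq ι] (x : ι → ℕ) (j : ι) :
    ∑ a, Function.update x j (x j + 1) a = ∑ a, x a + 1 := by
  rw [Finset.sum_update_of_mem (Finset.mem_univ j),
    ← Finset.add_sum_erase _ x (Finset.mem_univ j), Finset.sdiff_singleton_eq_erase]
  ring

lemma sum_update_pred {ι : Type*} [Fintype ι] [DecidableEq ι] (x : ι → ℕ) (j : ι)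
    (h : 0 < x j) :
    ∑ a, Function.update x j (x j - 1) a + 1 = ∑ a, x a := by
  rw [Finset.sum_update_of_mem (Finset.mem_univ j),
    ← Finset.add_sum_erase _ x (Finset.mem_univ j), Finset.sdiff_singleton_eq_erase]
  omega

lemma State.classTotal_addReq_self (st : L.State) (i : Fin m) (j : Fin (L.numAlloc i)) :
    (st.addReq i j).classTotal i = st.classTotal i + 1 := by
  rw [classTotal, classTotal, addReq_fst_self, sum_update_succ]
  change _ + st.2 i = _
  ring

lemma State.classTotal_addFict_self (st : L.State) (i : Fin m) :
    (st.addFict i).classTotal i = st.classTotal i + 1 := by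
  rw [classTotal, classTotal, addFict_snd_self]
  change (∑ j, st.1 i j) + _ = _
  ring

lemma State.classTotal_removeReq_self (st : L.State) (i : Fin m) (j : Fin (L.numAlloc i))
    (h : 0 < st.1 i j) : (st.removeReq i j).classTotal i + 1 = st.classTotal i := by
  rw [classTotal, classTotal, removeReq_fst_self, ← sum_update_pred (st.1 i) j h]
  change _ + st.2 i + 1 = _
  ring

lemma classTotal_afterArrival_self (d : L.Rule) (i : Fin m) (st : L.State) :
    (L.afterArrival d i st).classTotal i = st.classTotal i + 1 := by
  unfold afterArrival
  split
  · exact st.classTotal_addReq_self i _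
  · exact st.classTotal_addFict_self i

lemma afterArrival_of_ne (d : L.Rule) {i i' : Fin m} (h : i' ≠ i) (st : L.State) :
    (L.afterArrival d i st).1 i' = st.1 i' ∧ (L.afterArrival d i st).2 i' = st.2 i' := by
  unfold afterArrival
  split
  · exact ⟨st.addReq_fst_of_ne h _, rfl⟩
  · exact ⟨rfl, st.addFict_snd_of_ne h⟩

lemma total_afterArrival (d : L.Rule) (i : Fin m) (st : L.State) :
    (L.afterArrival d i st).total = st.total + 1 := by
  unfold State.total
  rw [← Finset.add_sum_erase _ _ (Finset.mem_univ i),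
    ← Finset.add_sum_erase _ (fun i => st.classTotal i) (Finset.mem_univ i),
    classTotal_afterArrival_self]
  have : ∑ i' ∈ Finset.univ.erase i, (L.afterArrival d i st).classTotal i' =
      ∑ i' ∈ Finset.univ.erase i, st.classTotal i' := by
    refine Finset.sum_congr rfl fun i' hi' => ?_
    obtain ⟨h1, h2⟩ := afterArrival_of_ne d (Finset.ne_of_mem_erase hi') st
    rw [State.classTotal, h1, h2]; rfl
  rw [this]; ring

lemma total_mono {st st' : L.State} (h : st ≤ st') : st.total ≤ st'.total :=
  Finset.sum_le_sum fun i _ => add_le_add (Finset.sum_le_sum fun j _ => h.1 i j) (h.2 i)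

lemma total_removeReq_le (st : L.State) (i : Fin m) (j : Fin (L.numAlloc i)) :
    (st.removeReq i j).total ≤ st.total := by
  refine total_mono ⟨fun i' => ?_, le_rfl⟩
  rcases eq_or_ne i' i with rfl | h
  · rw [State.removeReq_fst_self]
    intro a
    rcases eq_or_ne a j with rfl | h
    · simp
    · simp [h]
  · rw [State.removeReq_fst_of_ne st h]

lemma total_removeFict_le (st : L.State) (i : Fin m) :
    (st.removeFict i).total ≤ st.total := by
  refine total_mono ⟨le_rfl, fun i' => ?_⟩
  rcases eq_or_ne i' i with rfl | h
  · rw [State.removeFict_snd_self]; exact Nat.sub_le _ _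
  · rw [State.removeFict_snd_of_ne st h]

lemma total_le_of_classTotal_le {st st' : L.State} (i : Fin m)
    (h : st.classTotal i ≤ st'.classTotal i + 1)
    (h' : ∀ i', i' ≠ i → st.classTotal i' = st'.classTotal i') : st.total ≤ st'.total + 1 := by
  have h1 := Finset.add_sum_erase Finset.univ st.classTotal (Finset.mem_univ i)
  have h2 := Finset.add_sum_erase Finset.univ st'.classTotal (Finset.mem_univ i)
  rw [Finset.sum_congr rfl fun i' hi' => h' i' (Finset.ne_of_mem_erase hi')] at h1
  unfold State.total
  rw [← h1, ← h2]
  have := Nat.add_le_add_right h (∑ i' ∈ Finset.univ.erase i, st'.classTotal i')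
  refine this.trans (le_of_eq ?_)
  ring

lemma total_le_removeReq (st : L.State) (i : Fin m) (j : Fin (L.numAlloc i)) :
    st.total ≤ (st.removeReq i j).total + 1 := by
  refine total_le_of_classTotal_le i ?_ fun i' hi' => ?_
  · rcases Nat.eq_zero_or_pos (st.1 i j) with h | h
    · rw [State.classTotal, State.classTotal, State.removeReq_fst_self,
        show st.1 i j - 1 = st.1 i j by omega, Function.update_eq_self]
      exact Nat.le_succ _
    · exact (st.classTotal_removeReq_self i j h).ge
  · rw [State.classTotal, State.classTotal, State.removeReq_fst_of_ne st hi']; rfl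

lemma total_le_removeFict (st : L.State) (i : Fin m) :
    st.total ≤ (st.removeFict i).total + 1 := by
  refine total_le_of_classTotal_le i ?_ fun i' hi' => ?_
  · rw [State.classTotal, State.classTotal, State.removeFict_snd_self]
    change (∑ j, st.1 i j) + st.2 i ≤ (∑ j, st.1 i j) + (st.2 i - 1) + 1
    omega
  · rw [State.classTotal, State.classTotal, State.removeFict_snd_of_ne st hi']; rfl

lemma le_classTotal_fst (st : L.State) (i : Fin m) (j : Fin (L.numAlloc i)) :
    st.1 i j ≤ st.classTotal i :=
  (Finset.single_le_sum (f := fun j => st.1 i j) (fun _ _ => Nat.zero_le _)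
    (Finset.mem_univ j)).trans (Nat.le_add_right _ _)

lemma le_classTotal_snd (st : L.State) (i : Fin m) : st.2 i ≤ st.classTotal i :=
  Nat.le_add_left _ _

lemma classTotal_le_total (st : L.State) (i : Fin m) : st.classTotal i ≤ st.total :=
  Finset.single_le_sum (f := fun i => st.classTotal i) (fun _ _ => Nat.zero_le _)
    (Finset.mem_univ i)

lemma le_total_fst (st : L.State) (i : Fin m) (j : Fin (L.numAlloc i)) :
    st.1 i j ≤ st.total := (le_classTotal_fst st i j).trans (classTotal_le_total st i)

lemma le_total_snd (st : L.State) (i : Fin m) : st.2 i ≤ st.total :=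
  (le_classTotal_snd st i).trans (classTotal_le_total st i)

/-- Finite level sets make truncations by the total admissible test functions for the martingale
problem. -/
lemma finite_total_le (n : ℕ) : {st : L.State | st.total ≤ n}.Finite := by
  classical
  refine (Set.finite_Icc (0 : L.State) (fun _ _ => n, fun _ => n)).subset fun st hst => ?_
  exact ⟨⟨fun i j => Nat.zero_le _, fun i => Nat.zero_le _⟩,
    ⟨fun i j => (le_total_fst st i j).trans hst, fun i => (le_total_snd st i).trans hst⟩⟩

/-! ### Functions of at most exponential growth -/

/-- `f` grows at most exponentially in the number of requests. -/
def HasExpGrowth (f : L.State → ℝ) : Prop :=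
  ∃ C θ : ℝ, 0 ≤ C ∧ 1 ≤ θ ∧ ∀ st, |f st| ≤ C * θ ^ st.total

lemma HasExpGrowth.mono {f g : L.State → ℝ} (hg : HasExpGrowth g)
    (h : ∀ st, |f st| ≤ |g st|) : HasExpGrowth f := by
  obtain ⟨C, θ, hC, hθ, H⟩ := hg
  exact ⟨C, θ, hC, hθ, fun st => (h st).trans (H st)⟩

lemma hasExpGrowth_const (c : ℝ) : HasExpGrowth (fun _ : L.State => c) :=
  ⟨|c|, 1, abs_nonneg _, le_rfl, fun st => by simp⟩

lemma hasExpGrowth_pow {θ : ℝ} (hθ : 1 ≤ θ) : HasExpGrowth (fun st : L.State => θ ^ st.total) :=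
  ⟨1, θ, zero_le_one, hθ, fun st => by rw [abs_of_nonneg (by positivity), one_mul]⟩

lemma HasExpGrowth.add {f g : L.State → ℝ} (hf : HasExpGrowth f) (hg : HasExpGrowth g) :
    HasExpGrowth (fun st => f st + g st) := by
  obtain ⟨C, θ, hC, hθ, H⟩ := hf
  obtain ⟨C', θ', hC', hθ', H'⟩ := hg
  refine ⟨C + C', max θ θ', add_nonneg hC hC', hθ.trans (le_max_left _ _), fun st => ?_⟩
  calc |f st + g st| ≤ |f st| + |g st| := abs_add_le _ _
    _ ≤ C * θ ^ st.total + C' * θ' ^ st.total := add_le_add (H st) (H' st)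
    _ ≤ C * max θ θ' ^ st.total + C' * max θ θ' ^ st.total := by
        gcongr
        · exact le_max_left _ _
        · exact le_max_right _ _
    _ = _ := by ring

lemma HasExpGrowth.mul {f g : L.State → ℝ} (hf : HasExpGrowth f) (hg : HasExpGrowth g) :
    HasExpGrowth (fun st => f st * g st) := by
  obtain ⟨C, θ, hC, hθ, H⟩ := hf
  obtain ⟨C', θ', hC', hθ', H'⟩ := hg
  refine ⟨C * C', θ * θ', mul_nonneg hC hC', one_le_mul_of_one_le_of_one_le hθ hθ',
    fun st => ?_⟩
  calc |f st * g st| = |f st| * |g st| := abs_mul _ _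
    _ ≤ (C * θ ^ st.total) * (C' * θ' ^ st.total) :=
        mul_le_mul (H st) (H' st) (abs_nonneg _) (by positivity)
    _ = _ := by rw [mul_pow]; ring

lemma HasExpGrowth.const_mul {f : L.State → ℝ} (hf : HasExpGrowth f) (c : ℝ) :
    HasExpGrowth (fun st => c * f st) := (hasExpGrowth_const c).mul hf

lemma HasExpGrowth.sub {f g : L.State → ℝ} (hf : HasExpGrowth f) (hg : HasExpGrowth g) :
    HasExpGrowth (fun st => f st - g st) :=
  (hf.add (hg.const_mul (-1))).mono fun st => by rw [neg_one_mul, sub_eq_add_neg]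

lemma HasExpGrowth.sum {ι : Type*} {f : ι → L.State → ℝ} (t : Finset ι)
    (h : ∀ a ∈ t, HasExpGrowth (f a)) : HasExpGrowth (fun st => ∑ a ∈ t, f a st) := by
  classical
  induction t using Finset.induction_on with
  | empty => simpa using hasExpGrowth_const 0
  | insert a t ha ih =>
    simp only [Finset.sum_insert ha]
    exact (h a (Finset.mem_insert_self _ _)).add
      (ih fun b hb => h b (Finset.mem_insert_of_mem hb))

lemma HasExpGrowth.comp {f : L.State → ℝ} (hf : HasExpGrowth f) {g : L.State → L.State}
    (hg : ∀ st, (g st).total ≤ st.total + 1) : HasExpGrowth (fun st => f (g st)) := by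
  obtain ⟨C, θ, hC, hθ, H⟩ := hf
  refine ⟨C * θ, θ, by positivity, hθ, fun st => (H _).trans ?_⟩
  calc C * θ ^ (g st).total ≤ C * θ ^ (st.total + 1) := by
        gcongr
        exact hg st
    _ = _ := by ring

lemma hasExpGrowth_of_le_total {f : L.State → ℕ} (h : ∀ st, f st ≤ st.total) :
    HasExpGrowth (fun st => (f st : ℝ)) := by
  refine ⟨1, 2, zero_le_one, one_le_two, fun st => ?_⟩
  rw [abs_of_nonneg (Nat.cast_nonneg _), one_mul]
  have := (h st).trans Nat.lt_two_pow_self.le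
  change (f st : ℝ) ≤ _
  exact_mod_cast this

lemma hasExpGrowth_fst (i : Fin m) (j : Fin (L.numAlloc i)) :
    HasExpGrowth (fun st : L.State => (st.1 i j : ℝ)) :=
  hasExpGrowth_of_le_total fun st => le_total_fst st i j

lemma hasExpGrowth_snd (i : Fin m) : HasExpGrowth (fun st : L.State => (st.2 i : ℝ)) :=
  hasExpGrowth_of_le_total fun st => le_total_snd st i

lemma hasExpGrowth_exp_fst (c : ℝ) (i : Fin m) (j : Fin (L.numAlloc i)) :
    HasExpGrowth (fun st : L.State => Real.exp (c * st.1 i j)) := by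
  refine ⟨1, Real.exp |c|, zero_le_one, Real.one_le_exp (abs_nonneg _), fun st => ?_⟩
  rw [abs_of_pos (Real.exp_pos _), one_mul, ← Real.exp_nat_mul, Real.exp_le_exp]
  have h1 : (st.1 i j : ℝ) ≤ st.total := by exact_mod_cast le_total_fst st i j
  calc c * st.1 i j ≤ |c| * st.1 i j := by gcongr; exact le_abs_self c
    _ ≤ |c| * st.total := by gcongr
    _ = _ := mul_comm _ _

lemma hasExpGrowth_exp_snd (c : ℝ) (i : Fin m) :
    HasExpGrowth (fun st : L.State => Real.exp (c * st.2 i)) := by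
  refine ⟨1, Real.exp |c|, zero_le_one, Real.one_le_exp (abs_nonneg _), fun st => ?_⟩
  rw [abs_of_pos (Real.exp_pos _), one_mul, ← Real.exp_nat_mul, Real.exp_le_exp]
  have h1 : (st.2 i : ℝ) ≤ st.total := by exact_mod_cast le_total_snd st i
  calc c * st.2 i ≤ |c| * st.2 i := by gcongr; exact le_abs_self c
    _ ≤ |c| * st.total := by gcongr
    _ = _ := mul_comm _ _

lemma HasExpGrowth.prod {ι : Type*} {f : ι → L.State → ℝ} (t : Finset ι)
    (h : ∀ a ∈ t, HasExpGrowth (f a)) : HasExpGrowth (fun st => ∏ a ∈ t, f a st) := by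
  classical
  induction t using Finset.induction_on with
  | empty => simpa using hasExpGrowth_const 1
  | insert a t ha ih =>
    simp only [Finset.prod_insert ha]
    exact (h a (Finset.mem_insert_self _ _)).mul
      (ih fun b hb => h b (Finset.mem_insert_of_mem hb))

lemma HasExpGrowth.generator {f : L.State → ℝ} (hf : HasExpGrowth f) (d : L.Rule) :
    HasExpGrowth (L.generator d f) := by
  unfold LossNetwork.generator
  refine HasExpGrowth.add (HasExpGrowth.add ?_ ?_) ?_
  · exact HasExpGrowth.sum _ fun i _ =>
      ((hf.comp fun st => (total_afterArrival d i st).le).sub hf).const_mul _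
  · exact HasExpGrowth.sum _ fun i _ => HasExpGrowth.sum _ fun j _ =>
      ((hasExpGrowth_fst i j).const_mul _).mul
        ((hf.comp fun st => (total_removeReq_le st i j).trans (Nat.le_succ _)).sub hf)
  · exact HasExpGrowth.sum _ fun i _ =>
      ((hasExpGrowth_snd i).const_mul _).mul
        ((hf.comp fun st => (total_removeFict_le st i).trans (Nat.le_succ _)).sub hf)

/-- The growth bound of the generator is uniform over functions with a common growth bound. -/
lemma exists_growth_generator {C θ : ℝ} (hC : 0 ≤ C) (hθ : 1 ≤ θ) (d : L.Rule) :
    ∃ C' θ' : ℝ, 0 ≤ C' ∧ 1 ≤ θ' ∧ ∀ f : L.State → ℝ, (∀ st, |f st| ≤ C * θ ^ st.total) →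
      ∀ st, |L.generator d f st| ≤ C' * θ' ^ st.total := by
  have hpos : 0 ≤ C * θ := by positivity
  have hdiff : ∀ f : L.State → ℝ, (∀ st, |f st| ≤ C * θ ^ st.total) → ∀ st st' : L.State,
      st'.total ≤ st.total + 1 → |f st' - f st| ≤ 2 * C * θ * θ ^ st.total := by
    intro f hf st st' h
    have h1 : C * θ ^ st'.total ≤ C * θ * θ ^ st.total := by
      rw [mul_assoc, ← pow_succ']
      gcongr
    have h2 : C * θ ^ st.total ≤ C * θ * θ ^ st.total := by
      gcongr
      nlinarith
    calc |f st' - f st| ≤ |f st'| + |f st| := abs_sub _ _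
      _ ≤ C * θ * θ ^ st.total + C * θ * θ ^ st.total :=
          add_le_add ((hf _).trans h1) ((hf _).trans h2)
      _ = _ := by ring
  -- The dominating function is the generator with every increment replaced by its bound, so it
  -- depends on `f` only through `C` and `θ`.
  obtain ⟨C', θ', hC', hθ', H⟩ : HasExpGrowth (fun st : L.State =>
      ∑ i, L.arrivalRate i * (2 * C * θ * θ ^ st.total)
      + ∑ i, ∑ j, L.serviceRate i * (st.1 i j : ℝ) * (2 * C * θ * θ ^ st.total)
      + ∑ i, L.serviceRate i * (st.2 i : ℝ) * (2 * C * θ * θ ^ st.total)) := by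
    have h := (hasExpGrowth_pow (L := L) hθ).const_mul (2 * C * θ)
    exact HasExpGrowth.add (HasExpGrowth.add (HasExpGrowth.sum _ fun i _ => h.const_mul _)
      (HasExpGrowth.sum _ fun i _ => HasExpGrowth.sum _ fun j _ =>
        ((hasExpGrowth_fst i j).const_mul _).mul h))
      (HasExpGrowth.sum _ fun i _ => ((hasExpGrowth_snd i).const_mul _).mul h)
  refine ⟨C', θ', hC', hθ', fun f hf st => le_trans ?_ ((le_abs_self _).trans (H st))⟩
  have hμ := fun i => (L.serviceRate_pos i).le
  have hl := fun i => (L.arrivalRate_pos i).le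
  unfold LossNetwork.generator
  refine (abs_add_le _ _).trans (add_le_add ((abs_add_le _ _).trans (add_le_add ?_ ?_)) ?_)
  · refine (Finset.abs_sum_le_sum_abs _ _).trans (Finset.sum_le_sum fun i _ => ?_)
    rw [abs_mul, abs_of_nonneg (hl i)]
    exact mul_le_mul_of_nonneg_left (hdiff f hf _ _ (total_afterArrival d i st).le) (hl i)
  · refine (Finset.abs_sum_le_sum_abs _ _).trans (Finset.sum_le_sum fun i _ =>
      (Finset.abs_sum_le_sum_abs _ _).trans (Finset.sum_le_sum fun j _ => ?_))
    have h0 : 0 ≤ L.serviceRate i * (st.1 i j : ℝ) := mul_nonneg (hμ i) (Nat.cast_nonneg _)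
    rw [abs_mul, abs_of_nonneg h0]
    exact mul_le_mul_of_nonneg_left
      (hdiff f hf _ _ ((total_removeReq_le st i j).trans (Nat.le_succ _))) h0
  · refine (Finset.abs_sum_le_sum_abs _ _).trans (Finset.sum_le_sum fun i _ => ?_)
    have h0 : 0 ≤ L.serviceRate i * (st.2 i : ℝ) := mul_nonneg (hμ i) (Nat.cast_nonneg _)
    rw [abs_mul, abs_of_nonneg h0]
    exact mul_le_mul_of_nonneg_left
      (hdiff f hf _ _ ((total_removeFict_le st i).trans (Nat.le_succ _))) h0

/-! ### Dynkin's formula for functions of at most exponential growth -/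

section Dynkin

variable {d : L.Rule} {y₀ : Fin m → ℕ} {Ω : Type*} [mΩ : MeasurableSpace Ω] {P : Measure Ω}
  {ℱ : Filtration ℝ≥0 mΩ} {S : ℝ≥0 → Ω → L.State}

/-- The initial state: an empty network and `y₀ i` class `i` requests in the fictitious system. -/
def initialState (L : LossNetwork m s) (y₀ : Fin m → ℕ) : L.State := (fun _ _ => 0, y₀)

lemma IsStateChain.measurable_comp (hS : L.IsStateChain d y₀ P ℱ S) (f : L.State → ℝ) (t : ℝ≥0) :
    Measurable fun ω => f (S t ω) :=
  (measurable_of_countable f).comp ((hS.adapted t).mono (ℱ.le t) le_rfl)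

/-- Time is rounded to the grid point `(⌊(n+1)u⌋ + 1)/(n+1)`, which lies to the right of `u` and
tends to it. Paths are right-continuous and locally constant, so the approximations are eventually
equal to the value at `u`. -/
lemma IsStateChain.measurable_uncurry (hS : L.IsStateChain d y₀ P ℱ S) (f : L.State → ℝ) :
    Measurable fun p : ℝ × Ω => f (S p.1.toNNReal p.2) := by
  obtain ⟨g, hg⟩ : ∃ g : ℕ → ℕ → ℝ≥0, ∀ n k, g n k = ((k : ℝ≥0) + 1) / ((n : ℝ≥0) + 1) :=
    ⟨_, fun _ _ => rfl⟩
  have key : Measurable fun p : ℝ≥0 × Ω => f (S p.1 p.2) := by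
    refine measurable_of_tendsto_metrizable
      (f := fun (n : ℕ) (p : ℝ≥0 × Ω) => f (S (g n ⌊((n : ℝ≥0) + 1) * p.1⌋₊) p.2))
      (fun n => ?_) ?_
    · have h1 : Measurable fun p : ℕ × Ω => f (S (g n p.1) p.2) :=
        measurable_from_prod_countable_right fun k => hS.measurable_comp f (g n k)
      have h2 : Measurable fun p : ℝ≥0 × Ω => (⌊((n : ℝ≥0) + 1) * p.1⌋₊, p.2) :=
        (Nat.measurable_floor.comp (measurable_fst.const_mul _)).prodMk measurable_snd
      exact h1.comp h2
    · rw [tendsto_pi_nhds]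
      rintro ⟨u, ω⟩
      refine tendsto_const_nhds.congr' ?_
      have hge : ∀ n : ℕ, u ≤ ((⌊((n : ℝ≥0) + 1) * u⌋₊ : ℝ≥0) + 1) / ((n : ℝ≥0) + 1) := by
        intro n
        rw [le_div_iff₀ (by positivity), mul_comm]
        exact (Nat.lt_floor_add_one _).le
      have hle : ∀ n : ℕ, ((⌊((n : ℝ≥0) + 1) * u⌋₊ : ℝ≥0) + 1) / ((n : ℝ≥0) + 1) ≤
          u + 1 / ((n : ℝ≥0) + 1) := by
        intro n
        rw [add_div]
        gcongr
        rw [div_le_iff₀ (by positivity), mul_comm]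
        exact Nat.floor_le (by positivity)
      have hlim : Tendsto (fun n : ℕ => u + 1 / ((n : ℝ≥0) + 1)) atTop (𝓝 u) := by
        have := (tendsto_one_div_add_atTop_nhds_zero_nat (𝕜 := ℝ≥0)).const_add u
        simpa using this
      have ht : Tendsto (fun n : ℕ => ((⌊((n : ℝ≥0) + 1) * u⌋₊ : ℝ≥0) + 1) / ((n : ℝ≥0) + 1))
          atTop (𝓝[≥] u) :=
        tendsto_nhdsWithin_iff.2 ⟨tendsto_of_tendsto_of_tendsto_of_le_of_le tendsto_const_nhds
          hlim hge hle, Eventually.of_forall hge⟩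
      filter_upwards [ht.eventually (hS.right_cont ω u)] with n hn
      simp only [hg, hn]
  exact key.comp ((measurable_real_toNNReal.comp measurable_fst).prodMk measurable_snd)

lemma IsStateChain.integral_initial [IsProbabilityMeasure P] (hS : L.IsStateChain d y₀ P ℱ S)
    (f : L.State → ℝ) : ∫ ω, f (S 0 ω) ∂P = f (L.initialState y₀) := by
  have : (fun ω => f (S 0 ω)) =ᵐ[P] fun _ => f (L.initialState y₀) := by
    filter_upwards [hS.initial] with ω hω
    rw [hω]; rfl
  rw [integral_congr_ae this]
  simp

lemma exists_bound_of_finite_support {f : L.State → ℝ} (hf : f.support.Finite) :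
    ∃ B, ∀ st, |f st| ≤ B := by
  obtain ⟨B, hB⟩ := (hf.image fun st => |f st|).bddAbove
  refine ⟨max B 0, fun st => ?_⟩
  by_cases h : f st = 0
  · simp [h]
  · exact (hB ⟨st, h, rfl⟩).trans (le_max_left _ _)

/-- One jump changes the total by at most one, so the support moves up by at most one level. -/
lemma finite_support_generator {f : L.State → ℝ} (hf : f.support.Finite) (d : L.Rule) :
    (L.generator d f).support.Finite := by
  obtain ⟨n, hn⟩ := (hf.image State.total).bddAbove
  have h0 : ∀ st : L.State, n < st.total → f st = 0 := by
    intro st hst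
    by_contra h
    exact absurd (hn ⟨st, h, rfl⟩) (not_le.2 hst)
  refine (finite_total_le (n + 1)).subset fun st hst => ?_
  by_contra hlt
  rw [Set.mem_ofPred_eq, not_le] at hlt
  refine hst ?_
  have h1 : f st = 0 := h0 _ (by omega)
  have h2 : ∀ i, f (L.afterArrival d i st) = 0 := fun i => h0 _ (by
    rw [total_afterArrival]; omega)
  have h3 : ∀ i j, f (st.removeReq i j) = 0 := fun i j => h0 _ (by
    have := total_le_removeReq st i j; omega)
  have h4 : ∀ i, f (st.removeFict i) = 0 := fun i => h0 _ (by
    have := total_le_removeFict st i; omega)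
  simp [LossNetwork.generator, h1, h2, h3, h4]

/-- A martingale has constant mean; boundedness of the generator allows Fubini's theorem. -/
lemma IsStateChain.dynkin_of_finite_support [IsProbabilityMeasure P]
    (hS : L.IsStateChain d y₀ P ℱ S) {f : L.State → ℝ} (hf : f.support.Finite) {t : ℝ}
    (ht : 0 ≤ t) :
    ∫ ω, f (S t.toNNReal ω) ∂P = f (L.initialState y₀) +
      ∫ u in (0 : ℝ)..t, ∫ ω, L.generator d f (S u.toNNReal ω) ∂P := by
  have hM := hS.martingale f hf
  obtain ⟨B, hB⟩ := exists_bound_of_finite_support hf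
  obtain ⟨B', hB'⟩ := exists_bound_of_finite_support (finite_support_generator hf d)
  have : IsFiniteMeasure (volume.restrict (Set.uIoc 0 t)) := ⟨by simp [Set.uIoc]⟩
  have h1 := hM.setIntegral_eq (zero_le (a := t.toNNReal)) MeasurableSet.univ
  simp only [setIntegral_univ] at h1
  have hint : Integrable (fun ω => f (S t.toNNReal ω)) P :=
    Integrable.of_bound (hS.measurable_comp f _).aestronglyMeasurable B
      (Eventually.of_forall fun ω => hB _)
  have hint2 : Integrable (Function.uncurry fun (u : ℝ) ω => L.generator d f (S u.toNNReal ω))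
      ((volume.restrict (Set.uIoc 0 t)).prod P) :=
    Integrable.of_bound (hS.measurable_uncurry _).aestronglyMeasurable B'
      (Eventually.of_forall fun p => hB' _)
  have hint3 : Integrable (fun ω => ∫ u in (0 : ℝ)..t, L.generator d f (S u.toNNReal ω)) P := by
    have := hM.integrable t.toNNReal
    simp only [Real.coe_toNNReal _ ht] at this
    exact (hint.sub this).congr (Eventually.of_forall fun ω => by simp)
  rw [intervalIntegral_integral_swap hint2]
  simp only [Real.coe_toNNReal _ ht, NNReal.coe_zero, intervalIntegral.integral_same,
    sub_zero] at h1
  rw [hS.integral_initial, integral_sub hint hint3] at h1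
  linarith

end Dynkin

/-! ### Exponential moments and Dynkin's formula for unbounded functions. -/

section Moments

variable {d : L.Rule} {y₀ : Fin m → ℕ} {Ω : Type*} [mΩ : MeasurableSpace Ω] {P : Measure Ω}
  {ℱ : Filtration ℝ≥0 mΩ} {S : ℝ≥0 → Ω → L.State}

/-- Pointwise `θ^N ≤ θ^{n₀} + ∑ k, θ^{n₀+k} 1{N ≥ n₀+k}`, since the term `k = N - n₀` alone suffices
when `N ≥ n₀`. Integration produces an exponential series in `θ a`. -/
lemma integrable_pow_of_tail_le [IsFiniteMeasure P] {N : Ω → ℕ} (hN : Measurable N) {n₀ : ℕ}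
    {a : ℝ} (ha : 0 ≤ a) (h : ∀ k : ℕ, P.real {ω | n₀ + k ≤ N ω} ≤ a ^ k / k.factorial)
    {θ : ℝ} (hθ : 1 ≤ θ) :
    Integrable (fun ω => θ ^ N ω) P ∧
      ∫ ω, θ ^ N ω ∂P ≤ θ ^ n₀ * P.real Set.univ + ∑' k : ℕ, θ ^ n₀ * ((θ * a) ^ k / k.factorial) := by
  have hθ0 : 0 < θ := by linarith
  have hsum : Summable fun k : ℕ => θ ^ n₀ * ((θ * a) ^ k / k.factorial) :=
    (Real.summable_pow_div_factorial _).mul_left _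
  have hmeas : Measurable fun ω => θ ^ N ω := (measurable_of_countable fun n : ℕ => θ ^ n).comp hN
  have hset : ∀ k, MeasurableSet {ω | n₀ + k ≤ N ω} := fun k =>
    hN (measurableSet_Ici (a := n₀ + k))
  have hle : ∫⁻ ω, ENNReal.ofReal (θ ^ N ω) ∂P ≤ ENNReal.ofReal
      (θ ^ n₀ * P.real Set.univ + ∑' k : ℕ, θ ^ n₀ * ((θ * a) ^ k / k.factorial)) := by
    calc ∫⁻ ω, ENNReal.ofReal (θ ^ N ω) ∂P
        ≤ ∫⁻ ω, (ENNReal.ofReal (θ ^ n₀) + ∑' k : ℕ, {ω | n₀ + k ≤ N ω}.indicator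
            (fun _ => ENNReal.ofReal (θ ^ (n₀ + k))) ω) ∂P := by
          refine lintegral_mono fun ω => ?_
          rcases le_total (N ω) n₀ with hn | hn
          · exact (ENNReal.ofReal_le_ofReal (pow_le_pow_right₀ hθ hn)).trans le_self_add
          · obtain ⟨k, hk⟩ := Nat.exists_eq_add_of_le hn
            refine le_trans ?_ le_add_self
            refine le_trans ?_ (ENNReal.le_tsum k)
            have hmem : ω ∈ {ω | n₀ + k ≤ N ω} := hk.ge
            rw [Set.indicator_of_mem hmem, hk]
      _ = ENNReal.ofReal (θ ^ n₀) * P Set.univ +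
            ∑' k : ℕ, ENNReal.ofReal (θ ^ (n₀ + k)) * P {ω | n₀ + k ≤ N ω} := by
          rw [lintegral_add_left measurable_const, lintegral_const, lintegral_tsum]
          · simp_rw [lintegral_indicator_const (hset _)]
          · exact fun k => (measurable_const.indicator (hset k)).aemeasurable
      _ ≤ ENNReal.ofReal (θ ^ n₀ * P.real Set.univ) +
            ∑' k : ℕ, ENNReal.ofReal (θ ^ n₀ * ((θ * a) ^ k / k.factorial)) := by
          gcongr with k
          · rw [ENNReal.ofReal_mul (by positivity), ofReal_measureReal]
          · rw [← ofReal_measureReal (μ := P), ← ENNReal.ofReal_mul (by positivity)]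
            refine ENNReal.ofReal_le_ofReal ?_
            calc θ ^ (n₀ + k) * P.real {ω | n₀ + k ≤ N ω} ≤ θ ^ (n₀ + k) * (a ^ k / k.factorial) := by
                  gcongr
                  exact h k
              _ = _ := by rw [pow_add, mul_pow]; ring
      _ = _ := by
          rw [← ENNReal.ofReal_tsum_of_nonneg (fun k => by positivity) hsum,
            ← ENNReal.ofReal_add (by positivity) (tsum_nonneg fun k => by positivity)]
  have hnn : 0 ≤ θ ^ n₀ * P.real Set.univ + ∑' k : ℕ, θ ^ n₀ * ((θ * a) ^ k / k.factorial) :=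
    add_nonneg (by positivity) (tsum_nonneg fun k => by positivity)
  refine ⟨⟨hmeas.aestronglyMeasurable, ?_⟩, ?_⟩
  · rw [hasFiniteIntegral_iff_ofReal (Eventually.of_forall fun ω => by positivity)]
    exact hle.trans_lt ENNReal.ofReal_lt_top
  · rw [integral_eq_lintegral_of_nonneg_ae (Eventually.of_forall fun ω => by positivity)
      hmeas.aestronglyMeasurable]
    exact ENNReal.toReal_le_of_le_ofReal hnn hle

/-- Departures never increase the total, so only arrivals can leave the set, and only from states
with total exactly `n`. -/
lemma neg_generator_indicator_le (d : L.Rule) (n : ℕ) (st : L.State) :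
    -L.generator d (Set.indicator {st | st.total < n + 1} 1) st ≤
      (∑ i, L.arrivalRate i) * Set.indicator {st | n ≤ st.total} 1 st := by
  have hμ := fun i => (L.serviceRate_pos i).le
  have hl := fun i => (L.arrivalRate_pos i).le
  set f : L.State → ℝ := Set.indicator {st | st.total < n + 1} 1 with hf
  have h1 : ∀ i j, 0 ≤ f (st.removeReq i j) - f st := by
    intro i j
    have := total_removeReq_le st i j
    simp only [hf, Set.indicator_apply, Set.mem_ofPred_eq, Pi.one_apply]
    split_ifs <;> first | omega | norm_num
  have h2 : ∀ i, 0 ≤ f (st.removeFict i) - f st := by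
    intro i
    have := total_removeFict_le st i
    simp only [hf, Set.indicator_apply, Set.mem_ofPred_eq, Pi.one_apply]
    split_ifs <;> first | omega | norm_num
  have h3 : ∀ i, -Set.indicator {st : L.State | n ≤ st.total} 1 st ≤
      f (L.afterArrival d i st) - f st := by
    intro i
    simp only [hf, Set.indicator_apply, Set.mem_ofPred_eq, Pi.one_apply, total_afterArrival]
    split_ifs <;> first | omega | norm_num
  unfold LossNetwork.generator
  have e1 : 0 ≤ ∑ i, ∑ j, L.serviceRate i * (st.1 i j : ℝ) * (f (st.removeReq i j) - f st) :=
    Finset.sum_nonneg fun i _ => Finset.sum_nonneg fun j _ =>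
      mul_nonneg (mul_nonneg (hμ i) (Nat.cast_nonneg _)) (h1 i j)
  have e2 : 0 ≤ ∑ i, L.serviceRate i * (st.2 i : ℝ) * (f (st.removeFict i) - f st) :=
    Finset.sum_nonneg fun i _ => mul_nonneg (mul_nonneg (hμ i) (Nat.cast_nonneg _)) (h2 i)
  have e3 : ∑ i, L.arrivalRate i * (-Set.indicator {st : L.State | n ≤ st.total} 1 st) ≤
      ∑ i, L.arrivalRate i * (f (L.afterArrival d i st) - f st) :=
    Finset.sum_le_sum fun i _ => mul_le_mul_of_nonneg_left (h3 i) (hl i)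
  rw [← Finset.sum_mul] at e3
  linarith

/-- Induction on `k`: the probability of level `n₀+k+1` grows at rate at most `Λ` times that of
level `n₀+k`, and integrating `Λ (Λu)^k/k!` gives the next term. -/
lemma IsStateChain.tail_le [IsProbabilityMeasure P] (hS : L.IsStateChain d y₀ P ℱ S) (k : ℕ) :
    ∀ t : ℝ, 0 ≤ t → P.real {ω | (L.initialState y₀).total + k ≤ (S t.toNNReal ω).total} ≤
      ((∑ i, L.arrivalRate i) * t) ^ k / k.factorial := by
  set Λ := ∑ i, L.arrivalRate i with hΛ
  have hΛ0 : 0 ≤ Λ := Finset.sum_nonneg fun i _ => (L.arrivalRate_pos i).le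
  set n₀ := (L.initialState y₀).total with hn₀
  have hm : ∀ (n : ℕ) (t : ℝ≥0), MeasurableSet {ω | n ≤ (S t ω).total} := fun n t =>
    ((measurable_of_countable State.total).comp ((hS.adapted t).mono (ℱ.le t) le_rfl))
      (measurableSet_Ici (a := n))
  induction k with
  | zero => intro t _; simp
  | succ k ih =>
    intro t ht
    set f : L.State → ℝ := Set.indicator {st | st.total < n₀ + k + 1} 1 with hf
    have hfs : f.support.Finite := by
      refine (finite_total_le (n₀ + k + 1)).subset fun st hst => ?_
      have h : st ∈ {st : L.State | st.total < n₀ + k + 1} := Set.mem_of_indicator_ne_zero hst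
      exact (show st.total < n₀ + k + 1 from h).le
    have hD := hS.dynkin_of_finite_support hfs ht
    have hf0 : f (L.initialState y₀) = 1 := by
      rw [hf, Set.indicator_of_mem]
      · rfl
      · change n₀ < n₀ + k + 1; omega
    have hleft : ∫ ω, f (S t.toNNReal ω) ∂P =
        1 - P.real {ω | n₀ + (k + 1) ≤ (S t.toNNReal ω).total} := by
      rw [← probReal_compl_eq_one_sub (hm _ _), ← integral_indicator_one (hm _ _).compl]
      refine integral_congr_ae (Eventually.of_forall fun ω => ?_)
      simp only [hf, Set.indicator_apply, Set.mem_ofPred_eq, Set.mem_compl_iff, Pi.one_apply]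
      congr 1
      simp only [eq_iff_iff]
      omega
    obtain ⟨B', hB'⟩ := exists_bound_of_finite_support (finite_support_generator hfs d)
    have hmeasφ : Measurable fun u : ℝ => ∫ ω, L.generator d f (S u.toNNReal ω) ∂P :=
      ((hS.measurable_uncurry _).stronglyMeasurable.integral_prod_right').measurable
    have hφB : ∀ u : ℝ, |∫ ω, L.generator d f (S u.toNNReal ω) ∂P| ≤ B' := by
      intro u
      have h := norm_integral_le_of_norm_le_const (μ := P) (Eventually.of_forall
        fun ω => (Real.norm_eq_abs _).trans_le (hB' (S u.toNNReal ω)))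
      simpa using h
    have hint : IntervalIntegrable (fun u : ℝ => ∫ ω, L.generator d f (S u.toNNReal ω) ∂P)
        volume 0 t := by
      rw [intervalIntegrable_iff]
      exact Measure.integrableOn_of_bounded (M := B') (by simp [Set.uIoc])
        hmeasφ.aestronglyMeasurable (Eventually.of_forall hφB)
    have hbound : ∀ u ∈ Set.Icc 0 t, -(∫ ω, L.generator d f (S u.toNNReal ω) ∂P) ≤
        Λ * ((Λ * u) ^ k / k.factorial) := by
      intro u hu
      rw [← integral_neg]
      calc ∫ ω, -L.generator d f (S u.toNNReal ω) ∂P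
          ≤ ∫ ω, Λ * Set.indicator {ω | n₀ + k ≤ (S u.toNNReal ω).total} 1 ω ∂P := by
            refine integral_mono ?_ ?_ fun ω => ?_
            · exact (Integrable.of_bound (hS.measurable_comp _ _).aestronglyMeasurable B'
                (Eventually.of_forall fun ω => hB' _)).neg
            · exact (Integrable.indicator (integrable_const (1 : ℝ)) (hm _ _)).const_mul _
            · exact neg_generator_indicator_le d (n₀ + k) (S u.toNNReal ω)
        _ = Λ * P.real {ω | n₀ + k ≤ (S u.toNNReal ω).total} := by
            rw [integral_const_mul, integral_indicator_one (hm _ _)]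
        _ ≤ _ := mul_le_mul_of_nonneg_left (ih u hu.1) hΛ0
    have hI : ∫ u in (0 : ℝ)..t, Λ * ((Λ * u) ^ k / k.factorial) =
        (Λ * t) ^ (k + 1) / (k + 1).factorial := by
      simp_rw [mul_pow, div_eq_mul_inv, mul_assoc]
      rw [intervalIntegral.integral_const_mul, intervalIntegral.integral_const_mul,
        intervalIntegral.integral_mul_const, integral_pow, Nat.factorial_succ]
      push_cast
      field_simp
      ring
    have hmono := intervalIntegral.integral_mono_on ht hint.neg
      (Continuous.intervalIntegrable (by fun_prop) 0 t) hbound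
    simp only [Pi.neg_apply, intervalIntegral.integral_neg, hI] at hmono
    rw [hleft, hf0] at hD
    linarith

/-- Exponential moments of the number of requests are finite, uniformly on bounded time
intervals. -/
lemma IsStateChain.exists_moment_bound [IsProbabilityMeasure P] (hS : L.IsStateChain d y₀ P ℱ S)
    {θ : ℝ} (hθ : 1 ≤ θ) (T : ℝ) : ∃ B, ∀ t : ℝ, t ≤ T →
      Integrable (fun ω => θ ^ (S t.toNNReal ω).total) P ∧
        ∫ ω, θ ^ (S t.toNNReal ω).total ∂P ≤ B := by
  have hΛ0 : 0 ≤ ∑ i, L.arrivalRate i := Finset.sum_nonneg fun i _ => (L.arrivalRate_pos i).le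
  refine ⟨_, fun t ht => integrable_pow_of_tail_le
    ((measurable_of_countable State.total).comp ((hS.adapted _).mono (ℱ.le _) le_rfl))
    (n₀ := (L.initialState y₀).total) (a := (∑ i, L.arrivalRate i) * max T 0) (by positivity)
    (fun k => ?_) hθ⟩
  have h := hS.tail_le k (max t 0) (le_max_right _ _)
  have e : (max t 0).toNNReal = t.toNNReal := by
    rcases le_total 0 t with h | h
    · rw [max_eq_left h]
    · rw [max_eq_right h, Real.toNNReal_of_nonpos h, Real.toNNReal_zero]
  rw [e] at h
  refine h.trans ?_
  gcongr

lemma IsStateChain.integrable_comp [IsProbabilityMeasure P] (hS : L.IsStateChain d y₀ P ℱ S)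
    {f : L.State → ℝ} (hf : HasExpGrowth f) (t : ℝ≥0) : Integrable (fun ω => f (S t ω)) P := by
  obtain ⟨C, θ, hC, hθ, H⟩ := hf
  obtain ⟨B, hB⟩ := hS.exists_moment_bound hθ t
  have h1 := ((hB t le_rfl).1.const_mul C)
  rw [Real.toNNReal_coe] at h1
  exact h1.mono' (hS.measurable_comp f t).aestronglyMeasurable (Eventually.of_forall fun ω => H _)

lemma IsStateChain.measurable_integral [IsProbabilityMeasure P] (hS : L.IsStateChain d y₀ P ℱ S)
    (f : L.State → ℝ) : Measurable fun u : ℝ => ∫ ω, f (S u.toNNReal ω) ∂P :=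
  ((hS.measurable_uncurry f).stronglyMeasurable.integral_prod_right').measurable

lemma IsStateChain.exists_integral_bound [IsProbabilityMeasure P]
    (hS : L.IsStateChain d y₀ P ℱ S) {C θ : ℝ} (hC : 0 ≤ C) (hθ : 1 ≤ θ) (T : ℝ) :
    ∃ B, ∀ f : L.State → ℝ, (∀ st, |f st| ≤ C * θ ^ st.total) → ∀ t : ℝ, t ≤ T →
      |∫ ω, f (S t.toNNReal ω) ∂P| ≤ B := by
  obtain ⟨B, hB⟩ := hS.exists_moment_bound hθ T
  refine ⟨C * B, fun f hf t ht => ?_⟩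
  calc |∫ ω, f (S t.toNNReal ω) ∂P| ≤ ∫ ω, C * θ ^ (S t.toNNReal ω).total ∂P :=
        norm_integral_le_of_norm_le ((hB t ht).1.const_mul C)
          (Eventually.of_forall fun ω => (Real.norm_eq_abs _).trans_le (hf (S t.toNNReal ω)))
    _ = C * ∫ ω, θ ^ (S t.toNNReal ω).total ∂P := integral_const_mul _ _
    _ ≤ C * B := mul_le_mul_of_nonneg_left (hB t ht).2 hC

lemma IsStateChain.intervalIntegrable_integral [IsProbabilityMeasure P]
    (hS : L.IsStateChain d y₀ P ℱ S) {f : L.State → ℝ} (hf : HasExpGrowth f) (a b : ℝ) :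
    IntervalIntegrable (fun u : ℝ => ∫ ω, f (S u.toNNReal ω) ∂P) volume a b := by
  obtain ⟨C, θ, hC, hθ, H⟩ := hf
  obtain ⟨B, hB⟩ := hS.exists_integral_bound hC hθ (max a b)
  rw [intervalIntegrable_iff]
  refine Measure.integrableOn_of_bounded (M := B) (by simp [Set.uIoc])
    (hS.measurable_integral f).aestronglyMeasurable ?_
  rw [ae_restrict_iff' measurableSet_uIoc]
  exact Eventually.of_forall fun u hu => hB f H u hu.2

/-- Dynkin's formula. -/
lemma IsStateChain.dynkin [IsProbabilityMeasure P] (hS : L.IsStateChain d y₀ P ℱ S)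
    {f : L.State → ℝ} (hf : HasExpGrowth f) {t : ℝ} (ht : 0 ≤ t) :
    ∫ ω, f (S t.toNNReal ω) ∂P = f (L.initialState y₀) +
      ∫ u in (0 : ℝ)..t, ∫ ω, L.generator d f (S u.toNNReal ω) ∂P := by
  obtain ⟨C, θ, hC, hθ, H⟩ := id hf
  obtain ⟨C', θ', hC', hθ', H'⟩ := exists_growth_generator (L := L) hC hθ d
  obtain ⟨B, hB⟩ := hS.exists_integral_bound hC' hθ' t
  -- The truncations inherit the growth constants of `f`, so one bound from
  -- `exists_growth_generator` dominates all their generators.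
  set F : ℕ → L.State → ℝ := fun n => Set.indicator {st | st.total ≤ n} f with hF
  have hFs : ∀ n, (F n).support.Finite := fun n =>
    (finite_total_le n).subset fun st hst => Set.mem_of_indicator_ne_zero hst
  have hFle : ∀ n st, |F n st| ≤ C * θ ^ st.total := by
    intro n st
    refine le_trans ?_ (H st)
    simp only [hF, Set.indicator_apply]
    split_ifs <;> simp
  have hFlim : ∀ st, ∀ᶠ n in atTop, F n st = f st := by
    intro st
    filter_upwards [eventually_ge_atTop st.total] with n hn
    have hmem : st ∈ {st : L.State | st.total ≤ n} := hn
    exact Set.indicator_of_mem hmem f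
  have hGlim : ∀ st, Tendsto (fun n => L.generator d (F n) st) atTop (𝓝 (L.generator d f st)) := by
    intro st
    have h : ∀ st, Tendsto (fun n => F n st) atTop (𝓝 (f st)) := fun st =>
      tendsto_const_nhds.congr' ((hFlim st).mono fun n hn => hn.symm)
    unfold LossNetwork.generator
    exact ((tendsto_finsetSum _ fun i _ => ((h _).sub (h _)).const_mul _).add
      (tendsto_finsetSum _ fun i _ => tendsto_finsetSum _ fun j _ =>
        ((h _).sub (h _)).const_mul _)).add
      (tendsto_finsetSum _ fun i _ => ((h _).sub (h _)).const_mul _)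
  have lim1 : Tendsto (fun n => ∫ ω, F n (S t.toNNReal ω) ∂P) atTop
      (𝓝 (∫ ω, f (S t.toNNReal ω) ∂P)) := by
    refine tendsto_integral_of_dominated_convergence
      (fun ω => C * θ ^ (S t.toNNReal ω).total)
      (fun n => (hS.measurable_comp _ _).aestronglyMeasurable)
      (hS.integrable_comp ((hasExpGrowth_pow hθ).const_mul C) _)
      (fun n => Eventually.of_forall fun ω => hFle n _) (Eventually.of_forall fun ω => ?_)
    exact tendsto_const_nhds.congr' ((hFlim _).mono fun n hn => hn.symm)
  have lim2 : ∀ u : ℝ, Tendsto (fun n => ∫ ω, L.generator d (F n) (S u.toNNReal ω) ∂P) atTop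
      (𝓝 (∫ ω, L.generator d f (S u.toNNReal ω) ∂P)) := fun u =>
    tendsto_integral_of_dominated_convergence
      (fun ω => C' * θ' ^ (S u.toNNReal ω).total)
      (fun n => (hS.measurable_comp _ _).aestronglyMeasurable)
      (hS.integrable_comp ((hasExpGrowth_pow hθ').const_mul C') _)
      (fun n => Eventually.of_forall fun ω => H' _ (hFle n) _)
      (Eventually.of_forall fun ω => hGlim _)
  have lim3 : Tendsto (fun n => ∫ u in (0 : ℝ)..t, ∫ ω, L.generator d (F n) (S u.toNNReal ω) ∂P)
      atTop (𝓝 (∫ u in (0 : ℝ)..t, ∫ ω, L.generator d f (S u.toNNReal ω) ∂P)) := by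
    refine intervalIntegral.tendsto_integral_filter_of_dominated_convergence (fun _ => B)
      (Eventually.of_forall fun n => (hS.measurable_integral _).aestronglyMeasurable)
      (Eventually.of_forall fun n => Eventually.of_forall fun u hu => ?_)
      intervalIntegrable_const (Eventually.of_forall fun u _ => lim2 u)
    rw [Set.uIoc_of_le ht] at hu
    exact hB _ (H' _ (hFle n)) u hu.2
  have lim4 : Tendsto (fun n => F n (L.initialState y₀)) atTop (𝓝 (f (L.initialState y₀))) :=
    tendsto_const_nhds.congr' ((hFlim _).mono fun n hn => hn.symm)
  refine tendsto_nhds_unique lim1 ((lim4.add lim3).congr fun n => ?_)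
  exact (hS.dynkin_of_finite_support (hFs n) ht).symm

lemma IsStateChain.continuousOn_integral [IsProbabilityMeasure P]
    (hS : L.IsStateChain d y₀ P ℱ S) {f : L.State → ℝ} (hf : HasExpGrowth f) :
    ContinuousOn (fun u : ℝ => ∫ ω, f (S u.toNNReal ω) ∂P) (Set.Ici 0) := by
  have h := intervalIntegral.continuous_primitive
    (hS.intervalIntegrable_integral (hf.generator d)) 0
  exact (continuous_const.add h).continuousOn.congr fun u hu => hS.dynkin hf hu

/-- The integrand in Dynkin's formula is itself the mean of a function of exponential growth, hence
continuous, and the fundamental theorem of calculus applies. -/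
lemma IsStateChain.hasDerivAt_integral [IsProbabilityMeasure P]
    (hS : L.IsStateChain d y₀ P ℱ S) {f : L.State → ℝ} (hf : HasExpGrowth f) {t : ℝ}
    (ht : 0 < t) : HasDerivAt (fun u : ℝ => ∫ ω, f (S u.toNNReal ω) ∂P)
      (∫ ω, L.generator d f (S t.toNNReal ω) ∂P) t := by
  have h := intervalIntegral.integral_hasDerivAt_right
    (hS.intervalIntegrable_integral (hf.generator d) 0 t)
    (hS.measurable_integral _).stronglyMeasurable.stronglyMeasurableAtFilter
    ((hS.continuousOn_integral (hf.generator d)).continuousAt (Ici_mem_nhds ht))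
  refine (h.const_add (f (L.initialState y₀))).congr_of_eventuallyEq ?_
  filter_upwards [Ici_mem_nhds ht] with u hu using hS.dynkin hf hu

/-- Grönwall with integrating factor: `(φ - K) e^{at}` is antitone. -/
lemma le_of_hasDerivAt_le_affine {φ ψ : ℝ → ℝ} {a K : ℝ}
    (hc : ContinuousOn φ (Set.Ici 0)) (hd : ∀ t, 0 < t → HasDerivAt φ (ψ t) t)
    (hψ : ∀ t, 0 < t → ψ t ≤ a * (K - φ t)) {t : ℝ} (ht : 0 ≤ t) :
    φ t ≤ K + (φ 0 - K) * Real.exp (-a * t) := by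
  have hderiv : ∀ t, 0 < t → HasDerivAt (fun u => (φ u - K) * Real.exp (a * u))
      (ψ t * Real.exp (a * t) + (φ t - K) * (Real.exp (a * t) * a)) t := by
    intro t ht
    have h1 : HasDerivAt (fun u => Real.exp (a * u)) (Real.exp (a * t) * a) t := by
      simpa using ((hasDerivAt_id t).const_mul a).exp
    exact ((hd t ht).sub_const K).mul h1
  have hanti : AntitoneOn (fun u => (φ u - K) * Real.exp (a * u)) (Set.Ici 0) := by
    refine antitoneOn_of_deriv_nonpos (convex_Ici 0) ?_ ?_ ?_
    · exact (hc.sub continuousOn_const).mul (by fun_prop)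
    · rw [interior_Ici]
      exact fun u hu => (hderiv u hu).differentiableAt.differentiableWithinAt
    · rw [interior_Ici]
      intro u hu
      rw [(hderiv u hu).deriv]
      have := mul_le_mul_of_nonneg_right (hψ u hu) (Real.exp_pos (a * u)).le
      linarith
  have h := hanti (Set.mem_Ici.2 le_rfl) (Set.mem_Ici.2 ht) ht
  simp only [mul_zero, Real.exp_zero, mul_one] at h
  have h2 := mul_le_mul_of_nonneg_right h (Real.exp_pos (-a * t)).le
  rw [mul_assoc, ← Real.exp_add, show a * t + -a * t = 0 by ring, Real.exp_zero] at h2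
  linarith

/-- A pointwise drift bound for `f` yields a bound on its expectation. -/
lemma IsStateChain.integral_le_of_drift [IsProbabilityMeasure P]
    (hS : L.IsStateChain d y₀ P ℱ S) {f g : L.State → ℝ} (hf : HasExpGrowth f)
    (hg : HasExpGrowth g) {a K : ℝ} (hdrift : ∀ st, L.generator d f st ≤ g st - a * f st)
    (hK : ∀ t : ℝ≥0, ∫ ω, g (S t ω) ∂P ≤ a * K) (t : ℝ≥0) :
    ∫ ω, f (S t ω) ∂P ≤ K + (f (L.initialState y₀) - K) * Real.exp (-a * t) := by
  have h := le_of_hasDerivAt_le_affine (a := a) (K := K) (hS.continuousOn_integral hf)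
    (fun t ht => hS.hasDerivAt_integral hf ht) (fun u hu => ?_) t.coe_nonneg
  · simpa [hS.integral_initial] using h
  · calc ∫ ω, L.generator d f (S u.toNNReal ω) ∂P
        ≤ ∫ ω, (g (S u.toNNReal ω) - a * f (S u.toNNReal ω)) ∂P :=
          integral_mono (hS.integrable_comp (hf.generator d) _)
            (hS.integrable_comp (hg.sub (hf.const_mul a)) _) fun ω => hdrift _
      _ = ∫ ω, g (S u.toNNReal ω) ∂P - a * ∫ ω, f (S u.toNNReal ω) ∂P := by
          rw [integral_sub (hS.integrable_comp hg _)
            (hS.integrable_comp (hf.const_mul a) _), integral_const_mul]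
      _ ≤ _ := by linarith [hK u.toNNReal]

lemma IsStateChain.integral_le_of_drift_of_initial_le [IsProbabilityMeasure P]
    (hS : L.IsStateChain d y₀ P ℱ S) {f g : L.State → ℝ} (hf : HasExpGrowth f)
    (hg : HasExpGrowth g) {a K : ℝ} (hdrift : ∀ st, L.generator d f st ≤ g st - a * f st)
    (hK : ∀ t : ℝ≥0, ∫ ω, g (S t ω) ∂P ≤ a * K) (h0 : f (L.initialState y₀) ≤ K) (t : ℝ≥0) :
    ∫ ω, f (S t ω) ∂P ≤ K :=
  (hS.integral_le_of_drift hf hg hdrift hK t).trans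
    (by nlinarith [Real.exp_pos (-a * t)])

end Moments

end LossNetwork

/-! ### Elementary inequalities -/

/-- This and the next estimate linearise the penalty under one more or one less request. The factors
`1 + ε` and `1 - ε/2` are paid for in `IsTarget.rate_le`. -/
lemma exp_sub_one_le_mul {ε h : ℝ} (h0 : 0 ≤ h) (hh : h ≤ ε) (hε : ε ≤ 1) :
    Real.exp h - 1 ≤ (1 + ε) * h := by
  have h1 := Real.abs_exp_sub_one_sub_id_le (x := h) (by rw [abs_of_nonneg h0]; linarith)
  have h2 := (abs_le.1 h1).2
  nlinarith

lemma exp_neg_sub_one_le_mul {ε h : ℝ} (h0 : 0 ≤ h) (hh : h ≤ ε) :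
    Real.exp (-h) - 1 ≤ -((1 - ε / 2) * h) := by
  have h1 := Real.quadratic_le_exp_of_nonneg h0
  -- Because `(1 - h + h²/2)(1 + h + h²/2) = 1 + h⁴/4 ≥ 1`.
  have h2 : Real.exp (-h) ≤ 1 - h + h ^ 2 / 2 := by
    rw [Real.exp_neg, inv_le_iff_one_le_mul₀ (Real.exp_pos h)]
    have h3 : 0 ≤ 1 - h + h ^ 2 / 2 := by nlinarith [sq_nonneg (h - 1)]
    nlinarith [mul_le_mul_of_nonneg_left h1 h3, sq_nonneg (h ^ 2)]
  nlinarith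

/-- The convex function `x log x` lies above its tangent at `A`. This turns entropy-like drifts into
affine ones. -/
lemma mul_log_ge_tangent {x A : ℝ} (hx : 0 < x) (hA : 0 < A) :
    x * Real.log A + x - A ≤ x * Real.log x := by
  have h1 := Real.log_le_sub_one_of_pos (div_pos hA hx)
  rw [Real.log_div hA.ne' hx.ne'] at h1
  have h2 := mul_le_mul_of_nonneg_left h1 hx.le
  have h3 : x * (A / x - 1) = A - x := by field_simp
  linarith

/-- Splitting `m = m^a m^{1-a}` costs the constant `a^{-a} (1-a)^{-(1-a)}`. It is a weighted
geometric mean of `1/a` and `1/(1-a)`, whose arithmetic mean with weights `a`, `1-a` is `2`. -/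
lemma le_two_mul_rpow_mul_rpow {a m F Y : ℝ} (ha : 0 < a) (ha1 : a ≤ 1) (hm : 0 ≤ m)
    (hF : m * a ≤ F) (hY0 : 0 ≤ Y) (hY : m * (1 - a) ≤ Y) :
    m ≤ 2 * (F ^ a * Y ^ (1 - a)) := by
  have hF0 : 0 ≤ F := (mul_nonneg hm ha.le).trans hF
  rcases ha1.eq_or_lt with rfl | ha1
  · simp only [sub_self, Real.rpow_one, Real.rpow_zero]
    linarith
  have hb : 0 < 1 - a := by linarith
  have h1 : m ^ a * m ^ (1 - a) = m := by
    rw [← Real.rpow_add_of_nonneg hm ha.le hb.le]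
    simp
  have h2 : m ^ a ≤ (a⁻¹) ^ a * F ^ a := by
    rw [← Real.mul_rpow (by positivity) hF0]
    refine Real.rpow_le_rpow hm ?_ ha.le
    rw [inv_mul_eq_div, le_div_iff₀ ha]; exact hF
  have h3 : m ^ (1 - a) ≤ ((1 - a)⁻¹) ^ (1 - a) * Y ^ (1 - a) := by
    rw [← Real.mul_rpow (by positivity) hY0]
    refine Real.rpow_le_rpow hm ?_ hb.le
    rw [inv_mul_eq_div, le_div_iff₀ hb]; exact hY
  have h4 := Real.geom_mean_le_arith_mean2_weighted ha.le hb.le (inv_nonneg.2 ha.le)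
    (inv_nonneg.2 hb.le) (by ring)
  rw [mul_inv_cancel₀ ha.ne', mul_inv_cancel₀ hb.ne'] at h4
  calc m = m ^ a * m ^ (1 - a) := h1.symm
    _ ≤ ((a⁻¹) ^ a * F ^ a) * (((1 - a)⁻¹) ^ (1 - a) * Y ^ (1 - a)) :=
        mul_le_mul h2 h3 (by positivity) (by positivity)
    _ = ((a⁻¹) ^ a * ((1 - a)⁻¹) ^ (1 - a)) * (F ^ a * Y ^ (1 - a)) := by ring
    _ ≤ 2 * (F ^ a * Y ^ (1 - a)) :=
        mul_le_mul_of_nonneg_right (h4.trans (by norm_num)) (by positivity)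

/-- Bernoulli's inequality for exponents in `[0,1]`. -/
lemma rpow_le_of_le_mul_one_add {F F' p a : ℝ} (hF' : 0 ≤ F') (hF : 0 ≤ F)
    (h : F' ≤ F * (1 + p)) (hp : -1 ≤ p) (ha : 0 ≤ a) (ha1 : a ≤ 1) :
    F' ^ a ≤ F ^ a * (1 + a * p) := by
  calc F' ^ a ≤ (F * (1 + p)) ^ a := Real.rpow_le_rpow hF' h ha
    _ = F ^ a * (1 + p) ^ a := Real.mul_rpow hF (by linarith)
    _ ≤ F ^ a * (1 + a * p) := mul_le_mul_of_nonneg_left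
        (rpow_one_add_le_one_add_mul_self hp ha ha1) (by positivity)

lemma sum_update_natCast_mul {ι : Type*} [Fintype ι] [DecidableEq ι] (x : ι → ℕ) (j : ι) (n : ℕ)
    (w : ι → ℝ) : ∑ a, (Function.update x j n a : ℝ) * w a =
      ∑ a, (x a : ℝ) * w a + ((n : ℝ) - x j) * w j := by
  rw [← Finset.add_sum_erase _ _ (Finset.mem_univ j),
    ← Finset.add_sum_erase _ (fun a => (x a : ℝ) * w a) (Finset.mem_univ j),
    Finset.sum_congr rfl fun a ha => by
      rw [Function.update_of_ne (Finset.ne_of_mem_erase ha)]]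
  simp only [Function.update_self]
  ring

namespace LossNetwork

variable {m s : ℕ} {L : LossNetwork m s}

/-! ### The generator on functions of a single class -/

/-- The function of the state that depends on the requests of class `i` only. -/
def classFun (i : Fin m) (g : (Fin (L.numAlloc i) → ℕ) → ℕ → ℝ) (st : L.State) : ℝ :=
  g (st.1 i) (st.2 i)

lemma classFun_afterArrival_some {d : L.Rule} {i : Fin m} {st : L.State}
    {j : Fin (L.numAlloc i)} (h : d i st = some j) (g : (Fin (L.numAlloc i) → ℕ) → ℕ → ℝ) :
    classFun i g (L.afterArrival d i st) =
      g (Function.update (st.1 i) j (st.1 i j + 1)) (st.2 i) := by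
  have e : L.afterArrival d i st = st.addReq i j := by simp [afterArrival, h]
  rw [e, classFun, State.addReq_fst_self]; rfl

lemma classFun_afterArrival_none {d : L.Rule} {i : Fin m} {st : L.State}
    (h : d i st = none) (g : (Fin (L.numAlloc i) → ℕ) → ℕ → ℝ) :
    classFun i g (L.afterArrival d i st) = g (st.1 i) (st.2 i + 1) := by
  have e : L.afterArrival d i st = st.addFict i := by simp [afterArrival, h]
  rw [e, classFun, State.addFict_snd_self]; rfl

/-- Jumps of other classes leave the function unchanged, so a single class survives in each sum. -/
lemma generator_classFun (d : L.Rule) (i : Fin m) (g : (Fin (L.numAlloc i) → ℕ) → ℕ → ℝ)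
    (st : L.State) : L.generator d (classFun i g) st =
      L.arrivalRate i * (classFun i g (L.afterArrival d i st) - g (st.1 i) (st.2 i))
      + ∑ j, L.serviceRate i * (st.1 i j : ℝ) *
          (g (Function.update (st.1 i) j (st.1 i j - 1)) (st.2 i) - g (st.1 i) (st.2 i))
      + L.serviceRate i * (st.2 i : ℝ) *
          (g (st.1 i) (st.2 i - 1) - g (st.1 i) (st.2 i)) := by
  unfold LossNetwork.generator
  congr 1
  · congr 1
    · refine Finset.sum_eq_single_of_mem i (Finset.mem_univ i) fun i' _ hi' => ?_
      obtain ⟨h1, h2⟩ := afterArrival_of_ne d hi'.symm st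
      simp [classFun, h1, h2]
    · rw [Finset.sum_eq_single_of_mem i (Finset.mem_univ i)]
      · refine Finset.sum_congr rfl fun j _ => ?_
        simp only [classFun, State.removeReq_fst_self]
        rfl
      · intro i' _ hi'
        refine Finset.sum_eq_zero fun j _ => ?_
        have h1 := st.removeReq_fst_of_ne hi'.symm j
        have h2 : (st.removeReq i' j).2 i = st.2 i := rfl
        simp [classFun, h1, h2]
  · rw [Finset.sum_eq_single_of_mem i (Finset.mem_univ i)]
    · simp only [classFun, State.removeFict_snd_self]
      rfl
    · intro i' _ hi'
      have h1 := st.removeFict_snd_of_ne hi'.symm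
      have h2 : (st.removeFict i').1 i = st.1 i := rfl
      simp [classFun, h1, h2]

/-- The rule drops out because either destination adds exactly one request. -/
lemma generator_classTotal (d : L.Rule) (i : Fin m) (st : L.State) :
    L.generator d (fun st => (st.classTotal i : ℝ)) st =
      L.arrivalRate i - L.serviceRate i * st.classTotal i := by
  have h : (fun st : L.State => (st.classTotal i : ℝ)) =
      classFun i fun x y => ∑ j, (x j : ℝ) + y := by
    funext st
    simp [classFun, State.classTotal]
  have e : ∀ st : L.State, classFun i (fun x y => ∑ j, (x j : ℝ) + y) st = st.classTotal i :=
    fun st => (congrFun h st).symm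
  have hsum : ∀ (x : Fin (L.numAlloc i) → ℕ) j n, ∑ a, (Function.update x j n a : ℝ) =
      ∑ a, (x a : ℝ) + ((n : ℝ) - x j) := fun x j n => by
    simpa using sum_update_natCast_mul x j n fun _ => 1
  rw [h, generator_classFun, e, classTotal_afterArrival_self]
  have h1 : ∀ j, L.serviceRate i * (st.1 i j : ℝ) *
      (∑ a, (Function.update (st.1 i) j (st.1 i j - 1) a : ℝ) + (st.2 i : ℝ) -
        (∑ a, (st.1 i a : ℝ) + (st.2 i : ℝ))) = -(L.serviceRate i * (st.1 i j : ℝ)) := by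
    intro j
    rcases Nat.eq_zero_or_pos (st.1 i j) with h0 | h0
    · simp [h0]
    · rw [hsum, Nat.cast_pred h0]; ring
  have h2 : L.serviceRate i * (st.2 i : ℝ) *
      (∑ a, (st.1 i a : ℝ) + ((st.2 i - 1 : ℕ) : ℝ) - (∑ a, (st.1 i a : ℝ) + (st.2 i : ℝ))) =
      -(L.serviceRate i * (st.2 i : ℝ)) := by
    rcases Nat.eq_zero_or_pos (st.2 i) with h0 | h0
    · simp [h0]
    · rw [Nat.cast_pred h0]; ring
  simp only [h1, h2, State.classTotal, Nat.cast_add, Nat.cast_sum, Finset.sum_neg_distrib,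
    ← Finset.mul_sum, Nat.cast_one]
  ring

/-! ### The exponents of the penalty function -/

/-- The total fraction of class `i` requests that are to be admitted. -/
def accFrac (α : L.Fractions) (i : Fin m) : ℝ := ∑ j, α i j

/-- The increment of the exponent of the penalty of class `i` at resource `k` caused by one more
request at allocation `j`. -/
def resWeight (L : LossNetwork m s) (ε : ℝ) (α : L.Fractions) (β : ℝ) (i : Fin m)
    (j : Fin (L.numAlloc i)) (k : Fin s) : ℝ := β * (L.alloc i j k / L.resCapacity ε α i k)

/-- The increment of the exponent of the penalty in the fictitious system caused by one more
request of class `i`. -/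
def fictWeight (L : LossNetwork m s) (ε : ℝ) (α : L.Fractions) (β : ℝ) (i : Fin m) : ℝ :=
  β / L.fictCapacity ε α i

/-- The exponent of the penalty of class `i` at resource `k`. -/
def resExponent (L : LossNetwork m s) (ε : ℝ) (α : L.Fractions) (β : ℝ) (i : Fin m) (k : Fin s)
    (x : Fin (L.numAlloc i) → ℕ) : ℝ := ∑ j, (x j : ℝ) * L.resWeight ε α β i j k

lemma load_pos (L : LossNetwork m s) (i : Fin m) : 0 < L.load i :=
  div_pos (L.arrivalRate_pos i) (L.serviceRate_pos i)

lemma resMarginal_eq (ε : ℝ) (α : L.Fractions) (β : ℝ) (i : Fin m)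
    (x : Fin (L.numAlloc i) → ℕ) (j : Fin (L.numAlloc i)) :
    L.resMarginal ε α β i (fun a => (x a : ℝ)) j =
      ∑ k, L.resWeight ε α β i j k * Real.exp (L.resExponent ε α β i k x) := by
  unfold LossNetwork.resMarginal
  refine Finset.sum_congr rfl fun k _ => ?_
  set S := ∑ a, (x a : ℝ) * L.alloc i a k with hS
  set c := L.resCapacity ε α i k with hc
  have h1 : ∀ u : ℝ, L.resPenalty ε α β i k (Function.update (fun a => (x a : ℝ)) j u) =
      Real.exp (β * ((S + (u - x j) * L.alloc i j k) / c)) := by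
    intro u
    unfold LossNetwork.resPenalty
    congr 3
    rw [hS, ← Finset.add_sum_erase _ _ (Finset.mem_univ j),
      ← Finset.add_sum_erase _ (fun a => (x a : ℝ) * L.alloc i a k) (Finset.mem_univ j),
      Finset.sum_congr rfl fun a ha => by
        rw [Function.update_of_ne (Finset.ne_of_mem_erase ha)]]
    simp only [Function.update_self]
    ring
  simp_rw [h1]
  have h2 : HasDerivAt (fun u : ℝ => Real.exp (β * ((S + (u - x j) * L.alloc i j k) / c)))
      (Real.exp (β * ((S + ((x j : ℝ) - x j) * L.alloc i j k) / c)) *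
        (β * ((1 * L.alloc i j k) / c))) (x j) :=
    (((((hasDerivAt_id (x j : ℝ)).sub_const _).mul_const _).const_add _).div_const _
      |>.const_mul _).exp
  rw [h2.deriv, mul_comm]
  have h3 : L.resExponent ε α β i k x = β * (S / c) := by
    rw [resExponent, hS, Finset.sum_div, Finset.mul_sum]
    refine Finset.sum_congr rfl fun a _ => ?_
    rw [resWeight]; ring
  rw [h3, resWeight]
  simp [hc]

lemma deriv_fictPenalty (ε : ℝ) (α : L.Fractions) (β : ℝ) (i : Fin m) (y : ℝ) :
    deriv (L.fictPenalty ε α β i) y =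
      L.fictWeight ε α β i * Real.exp (L.fictWeight ε α β i * y) := by
  have h2 : HasDerivAt (L.fictPenalty ε α β i)
      (Real.exp (β * (y / L.fictCapacity ε α i)) * (β * (1 / L.fictCapacity ε α i))) y :=
    ((hasDerivAt_id y).div_const _ |>.const_mul _).exp
  rw [h2.deriv, fictWeight, mul_comm]
  congr 1
  · ring
  · congr 1; ring

/-! ### Consequences of feasibility and admissibility for capacities and weights. -/

section Feasible

variable {ε β : ℝ} {α : L.Fractions}

lemma IsFeasible.accFrac_le_one (hα : L.IsFeasible ε α) (i : Fin m) : accFrac α i ≤ 1 :=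
  hα.sum_le_one i

lemma IsFeasible.accFrac_nonneg (hα : L.IsFeasible ε α) (i : Fin m) : 0 ≤ accFrac α i :=
  Finset.sum_nonneg fun j _ => hα.nonneg i j

lemma IsFeasible.usage_nonneg (hα : L.IsFeasible ε α) (i : Fin m) (k : Fin s) :
    0 ≤ ∑ j, α i j * L.alloc i j k :=
  Finset.sum_nonneg fun j _ => mul_nonneg (hα.nonneg i j) (L.alloc_nonneg i j k)

lemma sum_usage_eq (α : L.Fractions) (k : Fin s) :
    ∑ i, ∑ j, α i j * L.load i * L.alloc i j k =
      ∑ i, (∑ j, α i j * L.alloc i j k) * L.load i := by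
  refine Finset.sum_congr rfl fun i _ => ?_
  rw [Finset.sum_mul]
  exact Finset.sum_congr rfl fun j _ => by ring

lemma IsFeasible.sum_usage_le (hα : L.IsFeasible ε α) (k : Fin s) :
    ∑ i, ∑ j, α i j * L.load i * L.alloc i j k ≤ 1 / (1 + 4 * ε) * L.capacity k := by
  rw [sum_usage_eq]
  refine le_trans (le_of_eq ?_) (hα.capacity_le k)
  refine Finset.sum_congr rfl fun i _ => ?_
  rw [mul_comm]
  congr 1
  exact Finset.sum_congr rfl fun j _ => mul_comm _ _

lemma IsFeasible.sum_usage_nonneg (hα : L.IsFeasible ε α) (k : Fin s) :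
    0 ≤ ∑ i, ∑ j, α i j * L.load i * L.alloc i j k := by
  rw [sum_usage_eq]
  exact Finset.sum_nonneg fun i _ => mul_nonneg (hα.usage_nonneg i k) (L.load_pos i).le

lemma IsFeasible.slack_nonneg (hα : L.IsFeasible ε α) (hε : 0 < ε) (k : Fin s) :
    0 ≤ L.slack ε α k :=
  div_nonneg (mul_nonneg (by positivity) (L.capacity_nonneg k)) (hα.sum_usage_nonneg k)

lemma IsFeasible.resCapacity_nonneg (hα : L.IsFeasible ε α) (hε : 0 < ε) (i : Fin m)
    (k : Fin s) : 0 ≤ L.resCapacity ε α i k :=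
  mul_nonneg (mul_nonneg (mul_nonneg (by positivity) (hα.slack_nonneg hε k))
    (hα.usage_nonneg i k)) (L.load_pos i).le

lemma IsFeasible.sum_resCapacity_le (hα : L.IsFeasible ε α) (hε : 0 < ε) (k : Fin s) :
    ∑ i, L.resCapacity ε α i k ≤ L.capacity k := by
  have h : ∑ i, L.resCapacity ε α i k = (1 + 4 * ε) * L.slack ε α k *
      ∑ i, ∑ j, α i j * L.load i * L.alloc i j k := by
    rw [sum_usage_eq, Finset.mul_sum]
    exact Finset.sum_congr rfl fun i _ => by rw [resCapacity]; ring
  rw [h, slack]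
  rcases (hα.sum_usage_nonneg k).eq_or_lt with h0 | h0
  · rw [← h0]; simpa using L.capacity_nonneg k
  · have : (1 + 4 * ε) ≠ 0 := by positivity
    field_simp
    exact le_rfl

/-- `slack` is normalised so that the shares exhaust the capacity; a positive share rules out a
vanishing denominator. The equality provides the weights for Jensen's inequality in
`IsTarget.one_le_of_not_fits`. -/
lemma IsFeasible.sum_resCapacity_eq (hα : L.IsFeasible ε α) (hε : 0 < ε) {i : Fin m} {k : Fin s}
    (h : 0 < L.resCapacity ε α i k) : ∑ i, L.resCapacity ε α i k = L.capacity k := by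
  have hsum : ∑ i, L.resCapacity ε α i k = (1 + 4 * ε) * L.slack ε α k *
      ∑ i, ∑ j, α i j * L.load i * L.alloc i j k := by
    rw [sum_usage_eq, Finset.mul_sum]
    exact Finset.sum_congr rfl fun i _ => by rw [resCapacity]; ring
  rw [hsum, slack]
  rcases (hα.sum_usage_nonneg k).eq_or_lt with h0 | h0
  · rw [resCapacity, slack, ← h0] at h
    simp at h
  · have : (1 + 4 * ε) ≠ 0 := by positivity
    field_simp

/-- Feasibility means `slack ≥ 1` when the resource is used, so a positive share is at least `1 +
4ε` times the planned usage. For a zero share the quotient is `0` by convention. -/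
lemma IsFeasible.load_mul_usage_div_le (hα : L.IsFeasible ε α) (hε : 0 < ε) (i : Fin m)
    (k : Fin s) : L.load i * ((∑ j, α i j * L.alloc i j k) / L.resCapacity ε α i k) ≤
      1 / (1 + 4 * ε) := by
  have hq : 0 < 1 + 4 * ε := by positivity
  rcases (hα.resCapacity_nonneg hε i k).eq_or_lt with h0 | h0
  · rw [← h0]; simp; positivity
  have hne : ∑ i, ∑ j, α i j * L.load i * L.alloc i j k ≠ 0 := by
    intro h
    rw [resCapacity, slack, h] at h0
    simp at h0
  have hpos : 0 < ∑ i, ∑ j, α i j * L.load i * L.alloc i j k :=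
    lt_of_le_of_ne (hα.sum_usage_nonneg k) hne.symm
  have hslack : 1 ≤ L.slack ε α k := by
    rw [slack, one_le_div hpos]; exact hα.sum_usage_le k
  rw [← mul_div_assoc, div_le_iff₀ h0]
  have hu := mul_nonneg (hα.usage_nonneg i k) (L.load_pos i).le
  calc L.load i * ∑ j, α i j * L.alloc i j k
      ≤ L.slack ε α k * ((∑ j, α i j * L.alloc i j k) * L.load i) := by nlinarith
    _ = _ := by rw [resCapacity]; field_simp

/-- A zero share would force `β ≤ 0`. Division by a zero share thus occurs only where the allocation
is zero too. -/
lemma IsAdmissible.resCapacity_pos (hadm : L.IsAdmissible ε α β) (hα : L.IsFeasible ε α)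
    (hε : 0 < ε) (hβ : 0 < β) {i : Fin m} {j : Fin (L.numAlloc i)} {k : Fin s}
    (h : 0 < L.alloc i j k) : 0 < L.resCapacity ε α i k := by
  refine lt_of_le_of_ne (hα.resCapacity_nonneg hε i k) fun h0 => ?_
  have := hadm.le_res i j k h
  rw [← h0] at this
  simp at this
  linarith

lemma IsFeasible.resWeight_nonneg (hα : L.IsFeasible ε α) (hε : 0 < ε) (hβ : 0 < β) (i : Fin m)
    (j : Fin (L.numAlloc i)) (k : Fin s) : 0 ≤ L.resWeight ε α β i j k :=
  mul_nonneg hβ.le (div_nonneg (L.alloc_nonneg i j k) (hα.resCapacity_nonneg hε i k))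

lemma IsAdmissible.resWeight_le (hadm : L.IsAdmissible ε α β) (hα : L.IsFeasible ε α)
    (hε : 0 < ε) (hβ : 0 < β) (i : Fin m) (j : Fin (L.numAlloc i)) (k : Fin s) :
    L.resWeight ε α β i j k ≤ ε := by
  rw [resWeight]
  rcases (L.alloc_nonneg i j k).eq_or_lt with h0 | h0
  · rw [← h0]; simpa using hε.le
  · have h1 := hadm.le_res i j k h0
    have h2 := hadm.resCapacity_pos hα hε hβ h0
    rw [← mul_div_assoc, div_le_iff₀ h2]
    rwa [← mul_div_assoc, le_div_iff₀ h0] at h1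

lemma IsFeasible.sum_frac_mul_resWeight_le (hα : L.IsFeasible ε α) (hε : 0 < ε) (hβ : 0 < β)
    (i : Fin m) (k : Fin s) :
    ∑ j, α i j * L.resWeight ε α β i j k ≤ β / ((1 + 4 * ε) * L.load i) := by
  have h := hα.load_mul_usage_div_le hε i k
  have h1 : ∑ j, α i j * L.resWeight ε α β i j k =
      β * ((∑ j, α i j * L.alloc i j k) / L.resCapacity ε α i k) := by
    rw [Finset.sum_div, Finset.mul_sum]
    exact Finset.sum_congr rfl fun j _ => by rw [resWeight]; ring
  have hl := L.load_pos i
  have hq : 0 < 1 + 4 * ε := by positivity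
  rw [h1, div_eq_mul_inv β]
  refine mul_le_mul_of_nonneg_left ?_ hβ.le
  rw [mul_inv, ← div_eq_mul_inv, le_div_iff₀ hl, mul_comm, ← one_div]
  exact h

lemma fictCapacity_eq (ε : ℝ) (α : L.Fractions) (i : Fin m) :
    L.fictCapacity ε α i = (1 + 4 * ε) * (1 - accFrac α i) * L.load i := rfl

lemma IsFeasible.fictCapacity_nonneg (hα : L.IsFeasible ε α) (hε : 0 < ε) (i : Fin m) :
    0 ≤ L.fictCapacity ε α i :=
  mul_nonneg (mul_nonneg (by positivity) (sub_nonneg.2 (hα.sum_le_one i))) (L.load_pos i).le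

lemma fictCapacity_eq_zero_iff (hε : 0 < ε) (α : L.Fractions) (i : Fin m) :
    L.fictCapacity ε α i = 0 ↔ 1 - accFrac α i = 0 := by
  have hq : 1 + 4 * ε ≠ 0 := by positivity
  simp [fictCapacity_eq, hq, (L.load_pos i).ne']

lemma IsFeasible.fictWeight_nonneg (hα : L.IsFeasible ε α) (hε : 0 < ε) (hβ : 0 < β) (i : Fin m) :
    0 ≤ L.fictWeight ε α β i := div_nonneg hβ.le (hα.fictCapacity_nonneg hε i)

lemma IsAdmissible.fictWeight_le (hadm : L.IsAdmissible ε α β) (hα : L.IsFeasible ε α)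
    (hε : 0 < ε) (i : Fin m) : L.fictWeight ε α β i ≤ ε := by
  rw [fictWeight]
  rcases (hα.fictCapacity_nonneg hε i).eq_or_lt with h0 | h0
  · rw [← h0]; simpa using hε.le
  · rw [div_le_iff₀ h0]
    refine hadm.le_fict i (lt_of_le_of_ne (hα.sum_le_one i) fun h => h0.ne' ?_)
    rw [fictCapacity_eq_zero_iff hε, accFrac, h, sub_self]

/-- The same rate `η` as in `IsFeasible.sum_frac_mul_resWeight_le`: both sides of the comparison
between network and fictitious system are calibrated alike. -/
lemma one_sub_mul_fictWeight (hε : 0 < ε) (i : Fin m) (h : L.fictCapacity ε α i ≠ 0) :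
    (1 - accFrac α i) * L.fictWeight ε α β i = β / ((1 + 4 * ε) * L.load i) := by
  have h1 : 1 - accFrac α i ≠ 0 := fun h0 => h ((fictCapacity_eq_zero_iff hε α i).2 h0)
  have hl := (L.load_pos i).ne'
  have hq : 1 + 4 * ε ≠ 0 := by positivity
  rw [fictWeight, fictCapacity_eq]
  field_simp

lemma one_sub_mul_fictWeight_le (hε : 0 < ε) (hβ : 0 < β) (i : Fin m) :
    (1 - accFrac α i) * L.fictWeight ε α β i ≤ β / ((1 + 4 * ε) * L.load i) := by
  by_cases h : L.fictCapacity ε α i = 0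
  · rw [(fictCapacity_eq_zero_iff hε α i).1 h, zero_mul]
    have := L.load_pos i
    positivity
  · exact (one_sub_mul_fictWeight hε i h).le

end Feasible

/-! ### Lyapunov functions of a single class -/

/-- The standing assumptions on the parameters of the penalty policy. -/
structure IsTarget (L : LossNetwork m s) (ε : ℝ) (α : L.Fractions) (β : ℝ) : Prop where
  feasible : L.IsFeasible ε α
  admissible : L.IsAdmissible ε α β
  eps_pos : 0 < ε
  eps_lt : ε < 1 / 4
  beta_pos : 0 < β

/-- The class `i` penalties of all resources, together with a fictitious unused resource. -/
def resSum (L : LossNetwork m s) (ε : ℝ) (α : L.Fractions) (β : ℝ) (i : Fin m)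
    (x : Fin (L.numAlloc i) → ℕ) : ℝ := 1 + ∑ k, Real.exp (L.resExponent ε α β i k x)

/-- The marginal penalty of allocation `j`. -/
def marg (L : LossNetwork m s) (ε : ℝ) (α : L.Fractions) (β : ℝ) (i : Fin m)
    (x : Fin (L.numAlloc i) → ℕ) (j : Fin (L.numAlloc i)) : ℝ :=
  ∑ k, L.resWeight ε α β i j k * Real.exp (L.resExponent ε α β i k x)

/-- The geometric mean, with weights `accFrac α i` and `1 - accFrac α i`, of the penalties in the
network and in the fictitious system. Its drift can be bounded whatever requests are admitted, as
long as admitted requests use the cheapest allocation. -/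
def mixed (L : LossNetwork m s) (ε : ℝ) (α : L.Fractions) (β : ℝ) (i : Fin m)
    (x : Fin (L.numAlloc i) → ℕ) (y : ℕ) : ℝ :=
  L.resSum ε α β i x ^ accFrac α i *
    Real.exp ((1 - accFrac α i) * L.fictWeight ε α β i * y)

lemma one_le_resSum (ε : ℝ) (α : L.Fractions) (β : ℝ) (i : Fin m)
    (x : Fin (L.numAlloc i) → ℕ) : 1 ≤ L.resSum ε α β i x :=
  le_add_of_nonneg_right (Finset.sum_nonneg fun _ _ => (Real.exp_pos _).le)

lemma resSum_pos (ε : ℝ) (α : L.Fractions) (β : ℝ) (i : Fin m)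
    (x : Fin (L.numAlloc i) → ℕ) : 0 < L.resSum ε α β i x :=
  zero_lt_one.trans_le (one_le_resSum ε α β i x)

lemma mixed_pos (ε : ℝ) (α : L.Fractions) (β : ℝ) (i : Fin m)
    (x : Fin (L.numAlloc i) → ℕ) (y : ℕ) : 0 < L.mixed ε α β i x y :=
  mul_pos (Real.rpow_pos_of_pos (resSum_pos ε α β i x) _) (Real.exp_pos _)

lemma log_mixed (ε : ℝ) (α : L.Fractions) (β : ℝ) (i : Fin m)
    (x : Fin (L.numAlloc i) → ℕ) (y : ℕ) : Real.log (L.mixed ε α β i x y) =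
      accFrac α i * Real.log (L.resSum ε α β i x) +
        (1 - accFrac α i) * L.fictWeight ε α β i * y := by
  rw [mixed, Real.log_mul (Real.rpow_pos_of_pos (resSum_pos ε α β i x) _).ne'
    (Real.exp_pos _).ne', Real.log_rpow (resSum_pos ε α β i x), Real.log_exp]

lemma exp_resExponent_update (ε : ℝ) (α : L.Fractions) (β : ℝ) (i : Fin m)
    (x : Fin (L.numAlloc i) → ℕ) (j : Fin (L.numAlloc i)) (n : ℕ) (k : Fin s) :
    Real.exp (L.resExponent ε α β i k (Function.update x j n)) =
      Real.exp (L.resExponent ε α β i k x) *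
        Real.exp (((n : ℝ) - x j) * L.resWeight ε α β i j k) := by
  rw [← Real.exp_add, resExponent, sum_update_natCast_mul]; rfl

section Target

variable {ε β : ℝ} {α : L.Fractions}

lemma IsTarget.resWeight_nonneg (T : L.IsTarget ε α β) (i : Fin m) (j : Fin (L.numAlloc i))
    (k : Fin s) : 0 ≤ L.resWeight ε α β i j k :=
  T.feasible.resWeight_nonneg T.eps_pos T.beta_pos i j k

lemma IsTarget.resWeight_le (T : L.IsTarget ε α β) (i : Fin m) (j : Fin (L.numAlloc i))
    (k : Fin s) : L.resWeight ε α β i j k ≤ ε :=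
  T.admissible.resWeight_le T.feasible T.eps_pos T.beta_pos i j k

lemma IsTarget.fictWeight_nonneg (T : L.IsTarget ε α β) (i : Fin m) :
    0 ≤ L.fictWeight ε α β i := T.feasible.fictWeight_nonneg T.eps_pos T.beta_pos i

lemma IsTarget.fictWeight_le (T : L.IsTarget ε α β) (i : Fin m) :
    L.fictWeight ε α β i ≤ ε := T.admissible.fictWeight_le T.feasible T.eps_pos i

lemma IsTarget.marg_nonneg (T : L.IsTarget ε α β) (i : Fin m) (x : Fin (L.numAlloc i) → ℕ)
    (j : Fin (L.numAlloc i)) : 0 ≤ L.marg ε α β i x j :=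
  Finset.sum_nonneg fun k _ => mul_nonneg (T.resWeight_nonneg i j k) (Real.exp_pos _).le

lemma IsTarget.marg_le (T : L.IsTarget ε α β) (i : Fin m) (x : Fin (L.numAlloc i) → ℕ)
    (j : Fin (L.numAlloc i)) : L.marg ε α β i x j ≤ ε * L.resSum ε α β i x := by
  rw [resSum, mul_add, Finset.mul_sum]
  refine (Finset.sum_le_sum fun k _ => mul_le_mul_of_nonneg_right (T.resWeight_le i j k)
    (Real.exp_pos _).le).trans (le_add_of_nonneg_left ?_)
  linarith [T.eps_pos]

lemma IsTarget.resSum_update_succ_le (T : L.IsTarget ε α β) (i : Fin m)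
    (x : Fin (L.numAlloc i) → ℕ) (j : Fin (L.numAlloc i)) :
    L.resSum ε α β i (Function.update x j (x j + 1)) ≤
      L.resSum ε α β i x + (1 + ε) * L.marg ε α β i x j := by
  rw [resSum, resSum, marg, Finset.mul_sum, add_assoc, ← Finset.sum_add_distrib]
  refine add_le_add le_rfl (Finset.sum_le_sum fun k _ => ?_)
  rw [exp_resExponent_update]
  have h := exp_sub_one_le_mul (T.resWeight_nonneg i j k) (T.resWeight_le i j k)
    (by linarith [T.eps_lt])
  have h1 := mul_le_mul_of_nonneg_left h (Real.exp_pos (L.resExponent ε α β i k x)).le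
  have h2 : (((x j + 1 : ℕ) : ℝ) - x j) * L.resWeight ε α β i j k = L.resWeight ε α β i j k := by
    push_cast; ring
  rw [h2]
  linarith

lemma IsTarget.resSum_update_pred_le (T : L.IsTarget ε α β) (i : Fin m)
    (x : Fin (L.numAlloc i) → ℕ) (j : Fin (L.numAlloc i)) (hx : 0 < x j) :
    L.resSum ε α β i (Function.update x j (x j - 1)) ≤
      L.resSum ε α β i x - (1 - ε / 2) * L.marg ε α β i x j := by
  rw [resSum, resSum, marg, Finset.mul_sum, add_sub_assoc, ← Finset.sum_sub_distrib]
  refine add_le_add le_rfl (Finset.sum_le_sum fun k _ => ?_)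
  rw [exp_resExponent_update]
  have h := exp_neg_sub_one_le_mul (T.resWeight_nonneg i j k) (T.resWeight_le i j k)
  have h1 := mul_le_mul_of_nonneg_left h (Real.exp_pos (L.resExponent ε α β i k x)).le
  have h2 : (((x j - 1 : ℕ) : ℝ) - x j) * L.resWeight ε α β i j k =
      -L.resWeight ε α β i j k := by
    rw [Nat.cast_pred hx]; ring
  rw [h2]
  linarith

lemma IsTarget.sum_frac_mul_marg_le (T : L.IsTarget ε α β) (i : Fin m)
    (x : Fin (L.numAlloc i) → ℕ) : ∑ j, α i j * L.marg ε α β i x j ≤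
      β / ((1 + 4 * ε) * L.load i) * (L.resSum ε α β i x - 1) := by
  have h : ∑ j, α i j * L.marg ε α β i x j =
      ∑ k, (∑ j, α i j * L.resWeight ε α β i j k) * Real.exp (L.resExponent ε α β i k x) := by
    simp_rw [marg, Finset.mul_sum, Finset.sum_mul]
    rw [Finset.sum_comm]
    exact Finset.sum_congr rfl fun k _ => Finset.sum_congr rfl fun j _ => by ring
  rw [h, resSum, add_sub_cancel_left, Finset.mul_sum]
  exact Finset.sum_le_sum fun k _ => mul_le_mul_of_nonneg_right
    (T.feasible.sum_frac_mul_resWeight_le T.eps_pos T.beta_pos i k) (Real.exp_pos _).le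

/-- A common lower bound of the marginal penalties is below their `α`-average, and `α` uses each
share to at most the fraction `1/(1+4ε)`. -/
lemma IsTarget.accFrac_mul_le (T : L.IsTarget ε α β) (i : Fin m)
    (x : Fin (L.numAlloc i) → ℕ) {M : ℝ} (hM : ∀ j, M ≤ L.marg ε α β i x j) :
    accFrac α i * M ≤ β / ((1 + 4 * ε) * L.load i) * (L.resSum ε α β i x - 1) := by
  refine le_trans ?_ (T.sum_frac_mul_marg_le i x)
  rw [accFrac, Finset.sum_mul]
  exact Finset.sum_le_sum fun j _ => mul_le_mul_of_nonneg_left (hM j) (T.feasible.nonneg i j)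

/-- Interchanging sums gives `∑ k, E_k e^{E_k}` with `E_k` the exponents. The tangent inequality
applies to each `k`, and `log A ≤ A - 1` covers the extra `1` in `resSum`. The point `A` is left
free: `F/(s+1)` suits `mixed`, `e^{β(1-ε)}` suits `resSum`. -/
lemma sum_mul_marg_ge (ε : ℝ) (α : L.Fractions) (β : ℝ) (i : Fin m)
    (x : Fin (L.numAlloc i) → ℕ) {A : ℝ} (hA : 0 < A) :
    L.resSum ε α β i x * Real.log A + L.resSum ε α β i x - (s + 1) * A ≤
      ∑ j, (x j : ℝ) * L.marg ε α β i x j := by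
  have h : ∑ j, (x j : ℝ) * L.marg ε α β i x j =
      ∑ k, Real.exp (L.resExponent ε α β i k x) *
        Real.log (Real.exp (L.resExponent ε α β i k x)) := by
    simp_rw [Real.log_exp]
    conv_rhs => enter [2, k, 2]; rw [resExponent]
    simp_rw [marg, Finset.mul_sum]
    rw [Finset.sum_comm]
    exact Finset.sum_congr rfl fun k _ => Finset.sum_congr rfl fun j _ => by ring
  have h1 := Finset.sum_le_sum fun k (_ : k ∈ Finset.univ) =>
    mul_log_ge_tangent (Real.exp_pos (L.resExponent ε α β i k x)) hA
  rw [← h, Finset.sum_sub_distrib, Finset.sum_add_distrib, ← Finset.sum_mul] at h1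
  simp only [Finset.sum_const, Finset.card_univ, Fintype.card_fin, nsmul_eq_mul] at h1
  have h2 := Real.log_le_sub_one_of_pos hA
  rw [resSum]
  nlinarith

/-- The marginal-cost comparison that makes admitted requests cheap. -/
lemma IsTarget.le_two_mul_mixed (T : L.IsTarget ε α β) (i : Fin m) (hi : 0 < accFrac α i)
    (x : Fin (L.numAlloc i) → ℕ) (y : ℕ) {M : ℝ} (hM0 : 0 ≤ M)
    (h1 : accFrac α i * M ≤ L.resSum ε α β i x)
    (h2 : (1 - accFrac α i) * M ≤ Real.exp (L.fictWeight ε α β i * y)) :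
    M ≤ 2 * L.mixed ε α β i x y := by
  have h := le_two_mul_rpow_mul_rpow (F := L.resSum ε α β i x) hi
    (T.feasible.accFrac_le_one i) hM0 (by rwa [mul_comm]) (Real.exp_pos (L.fictWeight ε α β i * y)).le (by rwa [mul_comm])
  rw [← Real.exp_mul] at h
  rw [mixed]
  convert h using 4
  ring

end Target

/-! ### Penalty rules -/

lemma isCheapest_iff {ε β : ℝ} {α : L.Fractions} {st : L.State} {i : Fin m}
    {j : Fin (L.numAlloc i)} : L.IsCheapest ε α β st i j ↔
      ∀ j', L.marg ε α β i (st.1 i) j ≤ L.marg ε α β i (st.1 i) j' := by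
  unfold LossNetwork.IsCheapest marg
  simp_rw [resMarginal_eq]

section Rule

variable {ε β : ℝ} {α : L.Fractions}

lemma condAccepted_iff {st : L.State} {i : Fin m} : L.CondAccepted ε α β st i ↔
    ∃ j, L.fictCapacity ε α i = 0 ∨ L.marg ε α β i (st.1 i) j ≤
      L.fictWeight ε α β i * Real.exp (L.fictWeight ε α β i * st.2 i) := by
  unfold LossNetwork.CondAccepted LossNetwork.fictMarginal marg
  simp_rw [resMarginal_eq]
  refine exists_congr fun j => ?_
  split_ifs with h
  · simp [h]
  · rw [EReal.coe_le_coe_iff, deriv_fictPenalty]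
    simp [h]

/-- An admitted request has small marginal penalty. -/
lemma IsTarget.marg_le_of_condAccepted (T : L.IsTarget ε α β) {i : Fin m}
    (hi : 0 < accFrac α i) {st : L.State} {j : Fin (L.numAlloc i)}
    (hc : L.CondAccepted ε α β st i) (hj : L.IsCheapest ε α β st i j) :
    L.marg ε α β i (st.1 i) j ≤
      β / ((1 + 4 * ε) * L.load i) * (2 * L.mixed ε α β i (st.1 i) (st.2 i)) := by
  have hq : 0 < 1 + 4 * ε := by linarith [T.eps_pos]
  have hη : 0 < β / ((1 + 4 * ε) * L.load i) := div_pos T.beta_pos (mul_pos hq (L.load_pos i))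
  rw [isCheapest_iff] at hj
  rw [condAccepted_iff] at hc
  rw [← div_le_iff₀' hη]
  -- Here `M` is the marginal penalty divided by `η`. Being cheapest bounds `aM`, the acceptance
  -- test bounds `(1-a)M`; if the fictitious capacity is zero, then `a = 1` and the second bound is
  -- trivial.
  refine T.le_two_mul_mixed i hi _ _ (div_nonneg (T.marg_nonneg i _ _) hη.le) ?_ ?_
  · rw [← mul_div_assoc, div_le_iff₀' hη]
    refine (T.accFrac_mul_le i _ hj).trans (mul_le_mul_of_nonneg_left (by linarith) hη.le)
  · rw [← mul_div_assoc, div_le_iff₀' hη]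
    obtain ⟨j', h | h⟩ := hc
    · rw [(fictCapacity_eq_zero_iff T.eps_pos α i).1 h, zero_mul]
      positivity
    · have h1 : 0 ≤ 1 - accFrac α i := sub_nonneg.2 (T.feasible.accFrac_le_one i)
      calc (1 - accFrac α i) * L.marg ε α β i (st.1 i) j
          ≤ (1 - accFrac α i) * (L.fictWeight ε α β i *
              Real.exp (L.fictWeight ε α β i * st.2 i)) :=
            mul_le_mul_of_nonneg_left ((hj j').trans h) h1
        _ = ((1 - accFrac α i) * L.fictWeight ε α β i) *
              Real.exp (L.fictWeight ε α β i * st.2 i) := by ring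
        _ ≤ _ := mul_le_mul_of_nonneg_right
            (one_sub_mul_fictWeight_le T.eps_pos T.beta_pos i) (Real.exp_pos _).le

/-- When a request is rejected, the penalty in the fictitious system is small. -/
lemma IsTarget.exp_le_of_not_condAccepted (T : L.IsTarget ε α β) {i : Fin m}
    (hi : 0 < accFrac α i) {st : L.State} (hc : ¬ L.CondAccepted ε α β st i) :
    L.fictCapacity ε α i ≠ 0 ∧ s ≠ 0 ∧ Real.exp (L.fictWeight ε α β i * st.2 i) ≤
      2 * L.mixed ε α β i (st.1 i) (st.2 i) := by
  have hq : 0 < 1 + 4 * ε := by linarith [T.eps_pos]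
  have hη : 0 < β / ((1 + 4 * ε) * L.load i) := div_pos T.beta_pos (mul_pos hq (L.load_pos i))
  rw [condAccepted_iff] at hc
  push Not at hc
  -- A positive accepted fraction provides an allocation; with none, refusal would carry no
  -- information.
  obtain ⟨j₀, -, hj₀⟩ := Finset.exists_lt_of_sum_lt (s := Finset.univ) (f := fun _ => (0 : ℝ))
    (g := fun j => α i j) (by simpa using (show 0 < ∑ j, α i j from hi))
  have hc0 : L.fictCapacity ε α i ≠ 0 := (hc j₀).1
  have hle := T.accFrac_mul_le i (st.1 i) fun j => (hc j).2.le
  have h1 : 0 < 1 - accFrac α i := lt_of_le_of_ne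
    (sub_nonneg.2 (T.feasible.accFrac_le_one i))
    (fun h => hc0 ((fictCapacity_eq_zero_iff T.eps_pos α i).2 h.symm))
  have hfw : 0 < L.fictWeight ε α β i := div_pos T.beta_pos
    (lt_of_le_of_ne (T.feasible.fictCapacity_nonneg T.eps_pos i) hc0.symm)
  set Y := Real.exp (L.fictWeight ε α β i * st.2 i) with hY
  have hYpos : 0 < Y := Real.exp_pos _
  refine ⟨hc0, ?_, ?_⟩
  · rintro rfl
    have h2 : L.marg ε α β i (st.1 i) j₀ = 0 := by simp [marg]
    have h3 := (hc j₀).2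
    rw [h2] at h3
    exact absurd h3 (not_lt.2 (mul_nonneg hfw.le hYpos.le))
  · have h3 : accFrac α i * (Y / (1 - accFrac α i)) ≤ L.resSum ε α β i (st.1 i) - 1 := by
      rw [← one_sub_mul_fictWeight T.eps_pos i hc0] at hle
      have h4 : accFrac α i * (L.fictWeight ε α β i * Y) =
          (1 - accFrac α i) * L.fictWeight ε α β i *
            (accFrac α i * (Y / (1 - accFrac α i))) := by
        field_simp
      rw [h4] at hle
      exact le_of_mul_le_mul_left hle (mul_pos h1 hfw)
    -- With `M = Y/(1-a)` refusal gives `aM ≤ F - 1`, while `(1-a)M = Y` exactly. The claim follows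
    -- from `Y ≤ M`.
    have h5 := T.le_two_mul_mixed i hi (st.1 i) (st.2 i) (M := Y / (1 - accFrac α i))
      (by positivity) (by linarith) (by rw [mul_div_cancel₀ _ h1.ne'])
    refine le_trans ?_ h5
    rw [le_div_iff₀ h1]
    have := mul_nonneg hi.le hYpos.le
    linarith

end Rule

/-! ### Drift bounds -/

section Drift

variable {ε β : ℝ} {α : L.Fractions} {d : L.Rule}

/-- Since `λ/ρ = μ`, this is `(1+ε)/(1+4ε) ≤ (1-ε/2)(1-ε)`, true for `0 < ε < 1/4`. The `4ε` absorbs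
both linearisation errors and still leaves `β(1-ε)` instead of `β`. -/
lemma IsTarget.rate_le (T : L.IsTarget ε α β) (i : Fin m) :
    L.arrivalRate i * ((1 + ε) * (β / ((1 + 4 * ε) * L.load i))) ≤
      L.serviceRate i * ((1 - ε / 2) * (β * (1 - ε))) := by
  have hq : 0 < 1 + 4 * ε := by linarith [T.eps_pos]
  have h1 : L.arrivalRate i * ((1 + ε) * (β / ((1 + 4 * ε) * L.load i))) =
      L.serviceRate i * β * ((1 + ε) / (1 + 4 * ε)) := by
    have := (L.serviceRate_pos i).ne'
    have := (L.arrivalRate_pos i).ne'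
    rw [load]
    field_simp
  have h2 : (1 + ε) / (1 + 4 * ε) ≤ (1 - ε / 2) * (1 - ε) := by
    rw [div_le_iff₀ hq]
    have h3 := mul_pos T.eps_pos (sub_pos.2 T.eps_lt)
    nlinarith [mul_nonneg T.eps_pos.le (sq_nonneg ε), T.eps_pos]
  rw [h1]
  have := mul_le_mul_of_nonneg_left h2 (mul_pos (L.serviceRate_pos i) T.beta_pos).le
  linarith

/-- Both routes have the same bound. On admission the relative increase `D/F` becomes `a D/F ≤ η`
through the power `a`; this needs only that the allocation is cheapest, neither the acceptance test
nor the capacity check. -/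
lemma IsTarget.mixed_afterArrival_le (T : L.IsTarget ε α β) (hd : L.IsPenaltyRule ε α β d)
    (i : Fin m) (st : L.State) :
    classFun i (L.mixed ε α β i) (L.afterArrival d i st) - L.mixed ε α β i (st.1 i) (st.2 i) ≤
      (1 + ε) * (β / ((1 + 4 * ε) * L.load i)) * L.mixed ε α β i (st.1 i) (st.2 i) := by
  have hF := resSum_pos ε α β i (st.1 i)
  have ha := T.feasible.accFrac_nonneg i
  have ha1 := T.feasible.accFrac_le_one i
  have hκ : 0 < 1 + ε := by linarith [T.eps_pos]
  set η := β / ((1 + 4 * ε) * L.load i) with hη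
  have hη0 : 0 ≤ η := div_nonneg T.beta_pos.le
    (mul_nonneg (by linarith [T.eps_pos]) (L.load_pos i).le)
  rcases hdec : d i st with _ | j
  · rw [classFun_afterArrival_none hdec, mixed, mixed]
    set h := (1 - accFrac α i) * L.fictWeight ε α β i with hh
    have h0 : 0 ≤ h := mul_nonneg (by linarith) (T.fictWeight_nonneg i)
    have h1 : h ≤ ε := by
      have := mul_le_mul_of_nonneg_right (show 1 - accFrac α i ≤ 1 by linarith)
        (T.fictWeight_nonneg i)
      linarith [T.fictWeight_le i]
    have h2 : h ≤ η := one_sub_mul_fictWeight_le T.eps_pos T.beta_pos i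
    have h3 := exp_sub_one_le_mul h0 h1 (by linarith [T.eps_lt])
    have h4 : Real.exp h - 1 ≤ (1 + ε) * η :=
      h3.trans (mul_le_mul_of_nonneg_left h2 hκ.le)
    have h5 : Real.exp (h * ((st.2 i + 1 : ℕ) : ℝ)) = Real.exp (h * st.2 i) * Real.exp h := by
      rw [← Real.exp_add]; push_cast; ring_nf
    rw [h5]
    have h6 := mul_le_mul_of_nonneg_left h4
      (show 0 ≤ L.resSum ε α β i (st.1 i) ^ accFrac α i * Real.exp (h * st.2 i) by positivity)
    linarith
  · rw [classFun_afterArrival_some hdec, mixed, mixed]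
    set F := L.resSum ε α β i (st.1 i) with hFdef
    set D := L.marg ε α β i (st.1 i) j with hD
    have hD0 : 0 ≤ D := T.marg_nonneg i _ j
    have hcheap := isCheapest_iff.1 (hd.accept i st j hdec).2.1
    have h1 : accFrac α i * D ≤ η * F := (T.accFrac_mul_le i _ hcheap).trans
      (mul_le_mul_of_nonneg_left (by linarith) hη0)
    have h2 : L.resSum ε α β i (Function.update (st.1 i) j (st.1 i j + 1)) ≤
        F * (1 + (1 + ε) * (D / F)) := by
      refine (T.resSum_update_succ_le i _ j).trans (le_of_eq ?_)
      rw [← hFdef, ← hD]; field_simp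
    have h3 := rpow_le_of_le_mul_one_add (resSum_pos ε α β i _).le hF.le h2
      (by have : 0 ≤ (1 + ε) * (D / F) := by positivity
          linarith) ha ha1
    have h4 : accFrac α i * ((1 + ε) * (D / F)) ≤ (1 + ε) * η := by
      have : accFrac α i * (D / F) ≤ η := by
        rw [← mul_div_assoc, div_le_iff₀ hF]; exact h1
      nlinarith
    have h5 : F ^ accFrac α i * (1 + accFrac α i * ((1 + ε) * (D / F))) ≤
        F ^ accFrac α i * (1 + (1 + ε) * η) := by gcongr
    have h6 := mul_le_mul_of_nonneg_right (h3.trans h5)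
      (Real.exp_pos ((1 - accFrac α i) * L.fictWeight ε α β i * st.2 i)).le
    linarith

lemma IsTarget.mixed_removeReq_le (T : L.IsTarget ε α β) (i : Fin m)
    (x : Fin (L.numAlloc i) → ℕ) (y : ℕ) (j : Fin (L.numAlloc i)) :
    (x j : ℝ) * (L.mixed ε α β i (Function.update x j (x j - 1)) y - L.mixed ε α β i x y) ≤
      -((1 - ε / 2) * accFrac α i * L.mixed ε α β i x y / L.resSum ε α β i x *
        ((x j : ℝ) * L.marg ε α β i x j)) := by
  rcases Nat.eq_zero_or_pos (x j) with h0 | h0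
  · simp [h0]
  have hF := resSum_pos ε α β i x
  have ha := T.feasible.accFrac_nonneg i
  have ha1 := T.feasible.accFrac_le_one i
  have hε := T.eps_pos
  have hε' := T.eps_lt
  set F := L.resSum ε α β i x with hFdef
  set D := L.marg ε α β i x j with hD
  have hD0 : 0 ≤ D := T.marg_nonneg i _ j
  -- Ensures that the relative decrease is at least `-1`, as Bernoulli's inequality requires.
  have hDF : D / F ≤ ε := by
    rw [div_le_iff₀ hF]; exact T.marg_le i x j
  have hDF0 : 0 ≤ D / F := div_nonneg hD0 hF.le
  have h2 : L.resSum ε α β i (Function.update x j (x j - 1)) ≤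
      F * (1 + -((1 - ε / 2) * (D / F))) := by
    refine (T.resSum_update_pred_le i _ j h0).trans (le_of_eq ?_)
    rw [← hFdef, ← hD]; field_simp; ring
  have h3 := rpow_le_of_le_mul_one_add (resSum_pos ε α β i _).le hF.le h2
    (by nlinarith) ha ha1
  have h4 := mul_le_mul_of_nonneg_right h3
    (Real.exp_pos ((1 - accFrac α i) * L.fictWeight ε α β i * y)).le
  have h5 : L.mixed ε α β i (Function.update x j (x j - 1)) y - L.mixed ε α β i x y ≤
      -((1 - ε / 2) * accFrac α i * L.mixed ε α β i x y / F * D) := by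
    rw [mixed, mixed, ← hFdef]
    refine (sub_le_sub_right h4 _).trans (le_of_eq ?_)
    field_simp
    ring
  refine (mul_le_mul_of_nonneg_left h5 (Nat.cast_nonneg (x j))).trans (le_of_eq ?_)
  ring

lemma IsTarget.mixed_removeFict_le (T : L.IsTarget ε α β) (i : Fin m)
    (x : Fin (L.numAlloc i) → ℕ) (y : ℕ) :
    (y : ℝ) * (L.mixed ε α β i x (y - 1) - L.mixed ε α β i x y) ≤
      -((1 - ε / 2) * L.mixed ε α β i x y *
        ((1 - accFrac α i) * L.fictWeight ε α β i * y)) := by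
  rcases Nat.eq_zero_or_pos y with h0 | h0
  · simp [h0]
  have ha := T.feasible.accFrac_nonneg i
  have ha1 := T.feasible.accFrac_le_one i
  set h := (1 - accFrac α i) * L.fictWeight ε α β i with hh
  have h0' : 0 ≤ h := mul_nonneg (by linarith) (T.fictWeight_nonneg i)
  have h1 : h ≤ ε := by
    have := mul_le_mul_of_nonneg_right (show 1 - accFrac α i ≤ 1 by linarith)
      (T.fictWeight_nonneg i)
    linarith [T.fictWeight_le i]
  have h2 : L.mixed ε α β i x (y - 1) = L.mixed ε α β i x y * Real.exp (-h) := by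
    rw [mixed, mixed, mul_assoc (_ ^ _), ← Real.exp_add, Nat.cast_pred h0, ← hh]
    congr 2
    ring
  have h3 := mul_le_mul_of_nonneg_left (exp_neg_sub_one_le_mul h0' h1)
    (mul_nonneg (Nat.cast_nonneg y) (mixed_pos ε α β i x y).le)
  rw [h2]
  linarith

/-- The stationary bound for the mixed penalty. -/
def mixedBound (s : ℕ) (ε a β : ℝ) : ℝ := (s + 1 : ℝ) ^ a * Real.exp (β * (1 - ε))

lemma mixedBound_pos (s : ℕ) (ε a β : ℝ) : 0 < mixedBound s ε a β := by
  unfold mixedBound; positivity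

lemma log_mixedBound (s : ℕ) (ε a β : ℝ) :
    Real.log (mixedBound s ε a β) = a * Real.log (s + 1) + β * (1 - ε) := by
  have hs : (0 : ℝ) < s + 1 := by positivity
  rw [mixedBound, Real.log_mul (by positivity) (Real.exp_pos _).ne', Real.log_rpow hs,
    Real.log_exp]

lemma mixedBound_le (s : ℕ) (ε β : ℝ) {a : ℝ} (ha : a ≤ 1) :
    mixedBound s ε a β ≤ (s + 1) * Real.exp (β * (1 - ε)) := by
  have hs : (1 : ℝ) ≤ s + 1 := by linarith [(Nat.cast_nonneg s : (0 : ℝ) ≤ s)]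
  have h := Real.rpow_le_rpow_of_exponent_le hs ha
  rw [Real.rpow_one] at h
  exact mul_le_mul_of_nonneg_right h (Real.exp_pos _).le

/-- With `κ = μ(1-ε/2)` and `C` the `mixedBound`, arrivals and departures add up to at most `κ G
(log C - log G)`. The tangent of `x log x` at `C` bounds this by `κ (C - G)`. -/
lemma IsTarget.generator_mixed_le (T : L.IsTarget ε α β) (hd : L.IsPenaltyRule ε α β d)
    (i : Fin m) (st : L.State) :
    L.generator d (classFun i (L.mixed ε α β i)) st ≤
      L.serviceRate i * (1 - ε / 2) * mixedBound s ε (accFrac α i) β -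
        L.serviceRate i * (1 - ε / 2) * classFun i (L.mixed ε α β i) st := by
  have hμ := L.serviceRate_pos i
  have hl := L.arrivalRate_pos i
  have hε := T.eps_pos
  have hε' := T.eps_lt
  have ha := T.feasible.accFrac_nonneg i
  have hs : (0 : ℝ) < s + 1 := by positivity
  have hκ' : 0 < 1 - ε / 2 := by linarith
  rw [generator_classFun]
  change _ ≤ _ - _ * L.mixed ε α β i (st.1 i) (st.2 i)
  set x := st.1 i with hx
  set y := st.2 i with hy
  have hF := resSum_pos ε α β i x
  have hG := mixed_pos ε α β i x y
  set F := L.resSum ε α β i x with hFdef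
  set G := L.mixed ε α β i x y with hGdef
  set a := accFrac α i with hadef
  set w := (1 - a) * L.fictWeight ε α β i * y with hw
  have e1 : L.arrivalRate i * (classFun i (L.mixed ε α β i) (L.afterArrival d i st) - G) ≤
      L.serviceRate i * ((1 - ε / 2) * (β * (1 - ε))) * G := by
    have h1 := mul_le_mul_of_nonneg_left (T.mixed_afterArrival_le hd i st) hl.le
    have h2 := mul_le_mul_of_nonneg_right (T.rate_le i) hG.le
    refine h1.trans (le_trans (le_of_eq ?_) h2)
    ring
  have e2 : ∑ j, L.serviceRate i * (x j : ℝ) *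
      (L.mixed ε α β i (Function.update x j (x j - 1)) y - G) ≤
      -(L.serviceRate i * ((1 - ε / 2) * a * G * (Real.log F - Real.log (s + 1)))) := by
    -- For `A = F/(s+1)` the linear terms cancel, leaving `F log (F/(s+1))`.
    have h1 := sum_mul_marg_ge ε α β i x (div_pos hF hs)
    rw [← hFdef, mul_div_cancel₀ _ hs.ne', add_sub_cancel_right,
      Real.log_div hF.ne' hs.ne'] at h1
    calc ∑ j, L.serviceRate i * (x j : ℝ) *
          (L.mixed ε α β i (Function.update x j (x j - 1)) y - G)
        ≤ ∑ j, L.serviceRate i * -((1 - ε / 2) * a * G / F *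
            ((x j : ℝ) * L.marg ε α β i x j)) := by
          refine Finset.sum_le_sum fun j _ => ?_
          rw [mul_assoc]
          exact mul_le_mul_of_nonneg_left (T.mixed_removeReq_le i x y j) hμ.le
      _ = -(L.serviceRate i * ((1 - ε / 2) * a * G / F *
            ∑ j, (x j : ℝ) * L.marg ε α β i x j)) := by
          rw [← Finset.mul_sum, Finset.sum_neg_distrib, ← Finset.mul_sum, mul_neg]
      _ ≤ -(L.serviceRate i * ((1 - ε / 2) * a * G / F *
            (F * (Real.log F - Real.log (s + 1))))) := by
          have h2 : 0 ≤ (1 - ε / 2) * a * G / F := by positivity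
          exact neg_le_neg (mul_le_mul_of_nonneg_left
            (mul_le_mul_of_nonneg_left h1 h2) hμ.le)
      _ = _ := by field_simp
  have e3 : L.serviceRate i * (y : ℝ) * (L.mixed ε α β i x (y - 1) - G) ≤
      -(L.serviceRate i * ((1 - ε / 2) * G * w)) := by
    have h1 := mul_le_mul_of_nonneg_left (T.mixed_removeFict_le i x y) hμ.le
    linarith
  have e4 : Real.log G = a * Real.log F + w := log_mixed ε α β i x y
  have e5 := mul_log_ge_tangent hG (mixedBound_pos s ε a β)
  rw [log_mixedBound, e4] at e5
  have e6 := mul_le_mul_of_nonneg_left e5 (mul_pos hμ hκ').le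
  linarith

/-- Here the acceptance test matters: `F` grows only through admitted requests, whose marginal
penalty is at most `2ηG`. -/
lemma IsTarget.generator_resSum_le (T : L.IsTarget ε α β) (hd : L.IsPenaltyRule ε α β d)
    {i : Fin m} (hi : 0 < accFrac α i) (st : L.State) :
    L.generator d (classFun i fun x _ => L.resSum ε α β i x) st ≤
      L.serviceRate i * (1 - ε / 2) * (2 * (β * (1 - ε)) * classFun i (L.mixed ε α β i) st +
        (s + 1) * Real.exp (β * (1 - ε))) -
        L.serviceRate i * (1 - ε / 2) * (β * (1 - ε) + 1) *
          classFun i (fun x _ => L.resSum ε α β i x) st := by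
  have hμ := L.serviceRate_pos i
  have hl := L.arrivalRate_pos i
  have hε := T.eps_pos
  have hε' := T.eps_lt
  have hκ' : 0 < 1 - ε / 2 := by linarith
  rw [generator_classFun]
  change _ ≤ _ * (_ * L.mixed ε α β i (st.1 i) (st.2 i) + _) -
    _ * L.resSum ε α β i (st.1 i)
  have hG := mixed_pos ε α β i (st.1 i) (st.2 i)
  have e1 : L.arrivalRate i * (classFun i (fun x _ => L.resSum ε α β i x)
        (L.afterArrival d i st) - L.resSum ε α β i (st.1 i)) ≤
      L.serviceRate i * ((1 - ε / 2) * (β * (1 - ε))) *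
        (2 * L.mixed ε α β i (st.1 i) (st.2 i)) := by
    rcases hdec : d i st with _ | j
    · rw [classFun_afterArrival_none hdec, sub_self, mul_zero]
      have : 0 < β * (1 - ε) := mul_pos T.beta_pos (by linarith)
      positivity
    · rw [classFun_afterArrival_some hdec]
      obtain ⟨hc, hj, -⟩ := hd.accept i st j hdec
      have h1 := T.resSum_update_succ_le i (st.1 i) j
      have h2 := mul_le_mul_of_nonneg_left (T.marg_le_of_condAccepted hi hc hj)
        (show 0 ≤ 1 + ε by linarith)
      have h3 := mul_le_mul_of_nonneg_left
        (sub_le_iff_le_add'.2 (h1.trans (add_le_add le_rfl h2))) hl.le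
      have h4 := mul_le_mul_of_nonneg_right (T.rate_le i)
        (show 0 ≤ 2 * L.mixed ε α β i (st.1 i) (st.2 i) by linarith)
      refine h3.trans (le_trans (le_of_eq ?_) h4)
      ring
  have e2 : ∑ j, L.serviceRate i * (st.1 i j : ℝ) *
      (L.resSum ε α β i (Function.update (st.1 i) j (st.1 i j - 1)) -
        L.resSum ε α β i (st.1 i)) ≤
      -(L.serviceRate i * ((1 - ε / 2) * ((β * (1 - ε) + 1) * L.resSum ε α β i (st.1 i) -
        (s + 1) * Real.exp (β * (1 - ε))))) := by
    have h1 := sum_mul_marg_ge ε α β i (st.1 i) (Real.exp_pos (β * (1 - ε)))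
    rw [Real.log_exp] at h1
    calc ∑ j, L.serviceRate i * (st.1 i j : ℝ) *
          (L.resSum ε α β i (Function.update (st.1 i) j (st.1 i j - 1)) -
            L.resSum ε α β i (st.1 i))
        ≤ ∑ j, L.serviceRate i * -((1 - ε / 2) *
            ((st.1 i j : ℝ) * L.marg ε α β i (st.1 i) j)) := by
          refine Finset.sum_le_sum fun j _ => ?_
          rw [mul_assoc]
          refine mul_le_mul_of_nonneg_left ?_ hμ.le
          rcases Nat.eq_zero_or_pos (st.1 i j) with h0 | h0
          · simp [h0]
          · have h2 := mul_le_mul_of_nonneg_left (T.resSum_update_pred_le i (st.1 i) j h0)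
              (Nat.cast_nonneg (α := ℝ) (st.1 i j))
            linarith
      _ = -(L.serviceRate i * ((1 - ε / 2) *
            ∑ j, (st.1 i j : ℝ) * L.marg ε α β i (st.1 i) j)) := by
          rw [← Finset.mul_sum, Finset.sum_neg_distrib, ← Finset.mul_sum, mul_neg]
      _ ≤ _ := by
          refine neg_le_neg (mul_le_mul_of_nonneg_left
            (mul_le_mul_of_nonneg_left ?_ hκ'.le) hμ.le)
          linarith
  have e3 : L.serviceRate i * (st.2 i : ℝ) *
    (L.resSum ε α β i (st.1 i) - L.resSum ε α β i (st.1 i)) = 0 := by rw [sub_self, mul_zero]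
  rw [e3]
  linarith

end Drift

/-! ### Expectations of the Lyapunov functions -/

section Expectation

variable {ε β : ℝ} {α : L.Fractions} {d : L.Rule} {y₀ : Fin m → ℕ} {Ω : Type*}
  [mΩ : MeasurableSpace Ω] {P : Measure Ω} {ℱ : Filtration ℝ≥0 mΩ} {S : ℝ≥0 → Ω → L.State}

lemma hasExpGrowth_resSum (ε : ℝ) (α : L.Fractions) (β : ℝ) (i : Fin m) :
    HasExpGrowth (classFun i fun x _ => L.resSum ε α β i x) := by
  unfold classFun resSum resExponent
  refine (hasExpGrowth_const 1).add (HasExpGrowth.sum _ fun k _ => ?_)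
  simp_rw [Real.exp_sum]
  refine HasExpGrowth.prod _ fun j _ => ?_
  simp_rw [mul_comm _ (L.resWeight ε α β i j k)]
  exact hasExpGrowth_exp_fst _ i j

lemma IsTarget.hasExpGrowth_mixed (T : L.IsTarget ε α β) (i : Fin m) :
    HasExpGrowth (classFun i (L.mixed ε α β i)) := by
  refine ((hasExpGrowth_resSum ε α β i).mul
    (hasExpGrowth_exp_snd ((1 - accFrac α i) * L.fictWeight ε α β i) i)).mono fun st => ?_
  have h1 := one_le_resSum ε α β i (st.1 i)
  simp only [classFun]
  rw [abs_of_pos (mixed_pos ε α β i _ _), abs_of_pos (mul_pos (resSum_pos ε α β i _)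
    (Real.exp_pos _))]
  have h2 := Real.rpow_le_rpow_of_exponent_le h1 (T.feasible.accFrac_le_one i)
  rw [Real.rpow_one] at h2
  exact mul_le_mul_of_nonneg_right h2 (Real.exp_pos _).le

lemma resSum_zero (ε : ℝ) (α : L.Fractions) (β : ℝ) (i : Fin m) :
    L.resSum ε α β i (fun _ => 0) = s + 1 := by
  simp [resSum, resExponent, add_comm]

lemma IsTarget.one_div_le (T : L.IsTarget ε α β) : 1 / (1 + 4 * ε) ≤ 1 - ε := by
  rw [div_le_iff₀ (by linarith [T.eps_pos])]
  nlinarith [mul_pos T.eps_pos (sub_pos.2 T.eps_lt), T.eps_pos]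

/-- The fictitious system starts at `1/(1+4ε)` of its capacity, and `1/(1+4ε) ≤ 1 - ε`. -/
lemma IsTarget.mixed_initial_le (T : L.IsTarget ε α β) {i : Fin m}
    (hy₀ : (y₀ i : ℝ) = (1 - ∑ j, α i j) * L.load i) :
    classFun i (L.mixed ε α β i) (L.initialState y₀) ≤ mixedBound s ε (accFrac α i) β := by
  change L.mixed ε α β i (fun _ => 0) (y₀ i) ≤ _
  rw [mixed, mixedBound, resSum_zero]
  refine mul_le_mul_of_nonneg_left (Real.exp_le_exp.2 ?_) (by positivity)
  have hl := L.load_pos i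
  have hq : 0 < 1 + 4 * ε := by linarith [T.eps_pos]
  have hβ := T.beta_pos
  have h0 := T.feasible.accFrac_nonneg i
  calc (1 - accFrac α i) * L.fictWeight ε α β i * y₀ i
      ≤ β / ((1 + 4 * ε) * L.load i) * y₀ i := mul_le_mul_of_nonneg_right
        (one_sub_mul_fictWeight_le T.eps_pos hβ i) (Nat.cast_nonneg _)
    _ = β * ((1 - accFrac α i) * (1 / (1 + 4 * ε))) := by
        rw [hy₀, accFrac]; field_simp
    _ ≤ β * (1 * (1 - ε)) := by
        have := T.one_div_le
        have : 0 ≤ 1 - ε := by linarith [T.eps_lt]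
        gcongr
        linarith
    _ = _ := by ring

lemma IsTarget.integral_mixed_le [IsProbabilityMeasure P] (T : L.IsTarget ε α β)
    (hd : L.IsPenaltyRule ε α β d) (hS : L.IsStateChain d y₀ P ℱ S) {i : Fin m}
    (hy₀ : (y₀ i : ℝ) = (1 - ∑ j, α i j) * L.load i) (t : ℝ≥0) :
    ∫ ω, classFun i (L.mixed ε α β i) (S t ω) ∂P ≤ mixedBound s ε (accFrac α i) β :=
  hS.integral_le_of_drift_of_initial_le (T.hasExpGrowth_mixed i) (hasExpGrowth_const _)
    (T.generator_mixed_le hd i) (fun t => by simp) (T.mixed_initial_le hy₀) t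

/-- With `v = β(1-ε)` and `D = (s+1)e^v`, the bound `E G ≤ D` makes the source term at most `(2v+1)
D ≤ (v+1) · 2D`. -/
lemma IsTarget.integral_resSum_le [IsProbabilityMeasure P] (T : L.IsTarget ε α β)
    (hd : L.IsPenaltyRule ε α β d) (hS : L.IsStateChain d y₀ P ℱ S) {i : Fin m}
    (hi : 0 < accFrac α i) (hy₀ : (y₀ i : ℝ) = (1 - ∑ j, α i j) * L.load i) (t : ℝ≥0) :
    ∫ ω, classFun i (fun x _ => L.resSum ε α β i x) (S t ω) ∂P ≤
      2 * ((s + 1) * Real.exp (β * (1 - ε))) := by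
  have hμ := L.serviceRate_pos i
  have hβ := T.beta_pos
  have hκ' : 0 < 1 - ε / 2 := by linarith [T.eps_lt]
  have hv : 0 < β * (1 - ε) := mul_pos hβ (by linarith [T.eps_lt])
  have hD : 0 < (s + 1 : ℝ) * Real.exp (β * (1 - ε)) := by positivity
  refine hS.integral_le_of_drift_of_initial_le (hasExpGrowth_resSum ε α β i)
    ((((T.hasExpGrowth_mixed i).const_mul (2 * (β * (1 - ε)))).add
      (hasExpGrowth_const ((s + 1) * Real.exp (β * (1 - ε))))).const_mul
        (L.serviceRate i * (1 - ε / 2))) (T.generator_resSum_le hd hi) (fun t => ?_) ?_ t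
  · have hint := hS.integrable_comp (T.hasExpGrowth_mixed i) t
    rw [integral_const_mul, integral_add (hint.const_mul _) (integrable_const _),
      integral_const_mul, mul_assoc (L.serviceRate i * (1 - ε / 2))]
    refine mul_le_mul_of_nonneg_left ?_ (by positivity)
    have h1 := (T.integral_mixed_le hd hS hy₀ t).trans
      (mixedBound_le s ε β (T.feasible.accFrac_le_one i))
    have h2 := mul_le_mul_of_nonneg_left h1 (show 0 ≤ 2 * (β * (1 - ε)) by positivity)
    simp only [integral_const, probReal_univ, one_smul]
    linarith
  · change L.resSum ε α β i (fun _ => 0) ≤ _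
    rw [resSum_zero]
    have : 1 ≤ Real.exp (β * (1 - ε)) := Real.one_le_exp hv.le
    have hs : (0 : ℝ) < s + 1 := by positivity
    nlinarith

/-! ### Requests that do not fit -/

lemma IsTarget.sum_alloc_mul_eq (T : L.IsTarget ε α β) (i : Fin m) (k : Fin s)
    (x : Fin (L.numAlloc i) → ℕ) : β * ∑ j, L.alloc i j k * (x j : ℝ) =
      L.resCapacity ε α i k * L.resExponent ε α β i k x := by
  rw [resExponent, Finset.mul_sum, Finset.mul_sum]
  refine Finset.sum_congr rfl fun j _ => ?_
  rw [resWeight]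
  rcases (L.alloc_nonneg i j k).eq_or_lt with h | h
  · simp [← h]
  · have := (T.admissible.resCapacity_pos T.feasible T.eps_pos T.beta_pos h).ne'
    field_simp

/-- The total penalty of the usage of the resources, normalised. -/
def usagePenalty (L : LossNetwork m s) (ε : ℝ) (α : L.Fractions) (β : ℝ) (st : L.State) : ℝ :=
  ∑ k, ∑ i, L.resCapacity ε α i k / L.capacity k * classFun i (fun x _ => L.resSum ε α β i x) st

/-- On the violated resource the exponents, averaged with the shares as weights, are at least `β -
ε`; the loss `ε` is the size of the new request, as `β b_{ij}(k) ≤ ε c_{ik} ≤ ε b_k`. Jensen's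
inequality for `exp` concludes. -/
lemma IsTarget.one_le_of_not_fits (T : L.IsTarget ε α β) {st : L.State} {i : Fin m}
    {j : Fin (L.numAlloc i)} (h : ¬ L.Fits st i j) :
    1 ≤ Real.exp (ε - β) * L.usagePenalty ε α β st := by
  have hβ := T.beta_pos
  have hcnn := fun i k => T.feasible.resCapacity_nonneg T.eps_pos i k
  have hwnn : ∀ i k, 0 ≤ L.resCapacity ε α i k / L.capacity k := fun i k =>
    div_nonneg (hcnn i k) (L.capacity_nonneg k)
  simp only [LossNetwork.Fits, not_forall, not_le] at h
  obtain ⟨k, hk⟩ := h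
  have hk' := mul_lt_mul_of_pos_left hk hβ
  rw [mul_add, Finset.mul_sum, Finset.sum_congr rfl fun i' _ =>
    T.sum_alloc_mul_eq i' k (st.1 i')] at hk'
  -- A resource with no shares is requested by nobody and cannot be violated.
  obtain ⟨i₀, hi₀⟩ : ∃ i₀, 0 < L.resCapacity ε α i₀ k := by
    by_contra hno
    push Not at hno
    have h0 : ∀ i', L.resCapacity ε α i' k = 0 := fun i' => le_antisymm (hno i') (hcnn i' k)
    have hb : L.alloc i j k = 0 := by
      rcases (L.alloc_nonneg i j k).eq_or_lt with h | h
      · exact h.symm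
      · exact absurd (h0 i)
          (T.admissible.resCapacity_pos T.feasible T.eps_pos T.beta_pos h).ne'
    simp only [h0, hb, zero_mul, Finset.sum_const_zero, mul_zero, add_zero] at hk'
    exact absurd hk' (not_lt.2 (mul_nonneg hβ.le (L.capacity_nonneg k)))
  have hsum := T.feasible.sum_resCapacity_eq T.eps_pos hi₀
  have hcap : 0 < L.capacity k := by
    rw [← hsum]
    exact hi₀.trans_le (Finset.single_le_sum (f := fun i => L.resCapacity ε α i k)
      (fun i _ => hcnn i k) (Finset.mem_univ i₀))
  have hsmall : β * L.alloc i j k ≤ ε * L.capacity k := by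
    have h2 : L.resCapacity ε α i k ≤ L.capacity k := by
      rw [← hsum]
      exact Finset.single_le_sum (f := fun i => L.resCapacity ε α i k)
        (fun i _ => hcnn i k) (Finset.mem_univ i)
    rcases (L.alloc_nonneg i j k).eq_or_lt with h | h
    · rw [← h, mul_zero]; exact mul_nonneg T.eps_pos.le hcap.le
    · have h1 := T.admissible.le_res i j k h
      rw [← mul_div_assoc, le_div_iff₀ h] at h1
      exact h1.trans (mul_le_mul_of_nonneg_left h2 T.eps_pos.le)
  have hexp : β - ε ≤ ∑ i', L.resCapacity ε α i' k / L.capacity k *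
      L.resExponent ε α β i' k (st.1 i') := by
    have e : ∑ i', L.resCapacity ε α i' k / L.capacity k * L.resExponent ε α β i' k (st.1 i') =
        (∑ i', L.resCapacity ε α i' k * L.resExponent ε α β i' k (st.1 i')) /
          L.capacity k := by
      rw [Finset.sum_div]
      exact Finset.sum_congr rfl fun i' _ => by ring
    rw [e, le_div_iff₀ hcap]
    linarith
  have hjensen := convexOn_exp.map_sum_le (t := Finset.univ)
    (w := fun i' => L.resCapacity ε α i' k / L.capacity k)
    (p := fun i' => L.resExponent ε α β i' k (st.1 i')) (fun i' _ => hwnn i' k)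
    (by rw [← Finset.sum_div, hsum, div_self hcap.ne']) (fun _ _ => Set.mem_univ _)
  simp only [smul_eq_mul] at hjensen
  have hle : Real.exp (β - ε) ≤ L.usagePenalty ε α β st := by
    refine (Real.exp_le_exp.2 hexp).trans (hjensen.trans ?_)
    refine le_trans (Finset.sum_le_sum fun i' _ => mul_le_mul_of_nonneg_left
      (b := Real.exp (L.resExponent ε α β i' k (st.1 i')))
      (c := classFun i' (fun x _ => L.resSum ε α β i' x) st) ?_ (hwnn i' k)) ?_
    · change _ ≤ L.resSum ε α β i' (st.1 i')
      rw [resSum]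
      exact (Finset.single_le_sum (f := fun k => Real.exp (L.resExponent ε α β i' k (st.1 i')))
        (fun _ _ => (Real.exp_pos _).le) (Finset.mem_univ k)).trans
        (le_add_of_nonneg_left zero_le_one)
    · exact Finset.single_le_sum (f := fun k => ∑ i', L.resCapacity ε α i' k / L.capacity k *
        classFun i' (fun x _ => L.resSum ε α β i' x) st)
        (fun k _ => Finset.sum_nonneg fun i' _ => mul_nonneg (hwnn i' k)
          (resSum_pos ε α β i' (st.1 i')).le) (Finset.mem_univ k)
  calc (1 : ℝ) = Real.exp (ε - β) * Real.exp (β - ε) := by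
        rw [← Real.exp_add]; simp
    _ ≤ _ := mul_le_mul_of_nonneg_left hle (Real.exp_pos _).le

lemma IsTarget.usagePenalty_nonneg (T : L.IsTarget ε α β) (st : L.State) :
    0 ≤ L.usagePenalty ε α β st :=
  Finset.sum_nonneg fun k _ => Finset.sum_nonneg fun i _ => mul_nonneg
    (div_nonneg (T.feasible.resCapacity_nonneg T.eps_pos i k) (L.capacity_nonneg k))
    (resSum_pos ε α β i (st.1 i)).le

lemma hasExpGrowth_usagePenalty (ε : ℝ) (α : L.Fractions) (β : ℝ) :
    HasExpGrowth (L.usagePenalty ε α β) :=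
  HasExpGrowth.sum _ fun _ _ => HasExpGrowth.sum _ fun i _ =>
    (hasExpGrowth_resSum ε α β i).const_mul _

lemma IsTarget.resCapacity_eq_zero (T : L.IsTarget ε α β) {i : Fin m}
    (hi : accFrac α i ≤ 0) (k : Fin s) : L.resCapacity ε α i k = 0 := by
  have h0 : ∀ j, α i j = 0 := fun j => by
    have := (Finset.sum_eq_zero_iff_of_nonneg fun j _ => T.feasible.nonneg i j).1
      (le_antisymm hi (T.feasible.accFrac_nonneg i))
    exact this j (Finset.mem_univ j)
  simp [resCapacity, h0]

lemma IsTarget.integral_usagePenalty_le [IsProbabilityMeasure P] (T : L.IsTarget ε α β)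
    (hd : L.IsPenaltyRule ε α β d) (hS : L.IsStateChain d y₀ P ℱ S)
    (hy₀ : ∀ i, (y₀ i : ℝ) = (1 - ∑ j, α i j) * L.load i) (t : ℝ≥0) :
    ∫ ω, L.usagePenalty ε α β (S t ω) ∂P ≤ s * (2 * ((s + 1) * Real.exp (β * (1 - ε)))) := by
  have hint := fun i k => (hS.integrable_comp (hasExpGrowth_resSum ε α β i) t).const_mul
    (L.resCapacity ε α i k / L.capacity k)
  unfold usagePenalty
  rw [integral_finsetSum _ fun k _ => integrable_finsetSum _ fun i _ => hint i k]
  refine (Finset.sum_le_sum fun k _ =>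
    (?_ : _ ≤ 2 * ((s + 1) * Real.exp (β * (1 - ε))))).trans (by simp)
  rw [integral_finsetSum _ fun i _ => hint i k]
  have hD : 0 ≤ 2 * ((s + 1 : ℝ) * Real.exp (β * (1 - ε))) := by positivity
  calc ∑ i, ∫ ω, L.resCapacity ε α i k / L.capacity k *
        classFun i (fun x _ => L.resSum ε α β i x) (S t ω) ∂P
      ≤ ∑ i, L.resCapacity ε α i k / L.capacity k *
          (2 * ((s + 1) * Real.exp (β * (1 - ε)))) := by
        refine Finset.sum_le_sum fun i _ => ?_
        rw [integral_const_mul]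
        -- `IsTarget.integral_resSum_le` needs a positive accepted fraction; the other classes carry
        -- zero weight.
        rcases le_or_gt (accFrac α i) 0 with hi | hi
        · simp [T.resCapacity_eq_zero hi]
        · exact mul_le_mul_of_nonneg_left (T.integral_resSum_le hd hS hi (hy₀ i) t)
            (div_nonneg (T.feasible.resCapacity_nonneg T.eps_pos i k) (L.capacity_nonneg k))
    _ = (∑ i, L.resCapacity ε α i k) / L.capacity k *
          (2 * ((s + 1) * Real.exp (β * (1 - ε)))) := by
        rw [← Finset.sum_mul, Finset.sum_div]
    _ ≤ 1 * (2 * ((s + 1) * Real.exp (β * (1 - ε)))) := by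
        refine mul_le_mul_of_nonneg_right ?_ hD
        exact div_le_one_of_le₀ (T.feasible.sum_resCapacity_le T.eps_pos k)
          (L.capacity_nonneg k)
    _ = _ := one_mul _

/-! ### The fictitious system -/

lemma hasExpGrowth_excess (i : Fin m) {A : ℝ} (hA : 0 ≤ A) :
    HasExpGrowth (classFun (L := L) i fun _ y => max ((y : ℝ) - A) 0) := by
  refine (hasExpGrowth_snd i).mono fun st => ?_
  have h : (0 : ℝ) ≤ st.2 i := Nat.cast_nonneg _
  rw [abs_of_nonneg h, abs_of_nonneg (le_max_right _ _)]
  exact max_le (by linarith) h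

/-- The excess rises only if a request is sent here with `y > A - 1`, by at most one, an event
dominated by `B`. A departure takes one unit at rate `y ≥ y - A` if `y - 1 ≥ A`, and otherwise the
whole excess at rate `y ≥ 1`. -/
lemma generator_excess_le {i : Fin m} {A : ℝ} (hA : 0 ≤ A) {B : L.State → ℝ}
    (hB : ∀ st, 0 ≤ B st) (hB' : ∀ st, d i st = none → A < st.2 i + 1 → 1 ≤ B st)
    (st : L.State) :
    L.generator d (classFun i fun _ y => max ((y : ℝ) - A) 0) st ≤
      L.arrivalRate i * B st -
        L.serviceRate i * classFun i (fun _ y => max ((y : ℝ) - A) 0) st := by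
  have hμ := L.serviceRate_pos i
  have hl := L.arrivalRate_pos i
  rw [generator_classFun]
  change _ ≤ _ - _ * max ((st.2 i : ℝ) - A) 0
  have e1 : classFun i (fun _ y => max ((y : ℝ) - A) 0) (L.afterArrival d i st) -
      max ((st.2 i : ℝ) - A) 0 ≤ B st := by
    rcases hdec : d i st with _ | j
    · rw [classFun_afterArrival_none hdec]
      push_cast
      rcases lt_or_ge A (st.2 i + 1) with h | h
      · have h1 := hB' st hdec h
        have h2 : max ((st.2 i : ℝ) + 1 - A) 0 ≤ max ((st.2 i : ℝ) - A) 0 + 1 :=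
          max_le (by linarith [le_max_left ((st.2 i : ℝ) - A) 0])
            (by linarith [le_max_right ((st.2 i : ℝ) - A) 0])
        linarith
      · rw [max_eq_right (by linarith : (st.2 i : ℝ) + 1 - A ≤ 0)]
        linarith [hB st, le_max_right ((st.2 i : ℝ) - A) 0]
    · rw [classFun_afterArrival_some hdec, sub_self]
      exact hB st
  have e3 : (st.2 i : ℝ) * (max (((st.2 i - 1 : ℕ) : ℝ) - A) 0 - max ((st.2 i : ℝ) - A) 0) ≤
      -max ((st.2 i : ℝ) - A) 0 := by
    rcases Nat.eq_zero_or_pos (st.2 i) with h0 | h0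
    · simp [h0, hA]
    · rw [Nat.cast_pred h0]
      have h1 : (1 : ℝ) ≤ st.2 i := by exact_mod_cast h0
      rcases le_total ((st.2 i : ℝ) - A) 0 with h | h
      · rw [max_eq_right h, max_eq_right (by linarith)]; simp
      · rw [max_eq_left h]
        rcases le_total ((st.2 i : ℝ) - 1 - A) 0 with h' | h'
        · rw [max_eq_right h']; nlinarith
        · rw [max_eq_left h']; nlinarith
  have e1' := mul_le_mul_of_nonneg_left e1 hl.le
  have e3' := mul_le_mul_of_nonneg_left e3 hμ.le
  simp only [sub_self, mul_zero, Finset.sum_const_zero, add_zero]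
  linarith

/-- The excess starts at zero and relaxes towards `δ ρ_i`, whence the factor `1 - e^{-μ_i t}`. -/
lemma IsStateChain.integral_snd_le [IsProbabilityMeasure P] (hS : L.IsStateChain d y₀ P ℱ S)
    {i : Fin m} {A δ : ℝ} (hA : 0 ≤ A) (hy₀A : (y₀ i : ℝ) ≤ A) {B : L.State → ℝ}
    (hBg : HasExpGrowth B) (hB : ∀ st, 0 ≤ B st)
    (hB' : ∀ st, d i st = none → A < st.2 i + 1 → 1 ≤ B st)
    (hBδ : ∀ t : ℝ≥0, ∫ ω, B (S t ω) ∂P ≤ δ) (t : ℝ≥0) :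
    ∫ ω, ((S t ω).2 i : ℝ) ∂P ≤
      A + δ * (L.load i * (1 - Real.exp (-L.serviceRate i * t))) := by
  have hμ := L.serviceRate_pos i
  have hl := L.arrivalRate_pos i
  have h1 := hS.integral_le_of_drift (hasExpGrowth_excess i hA) (hBg.const_mul (L.arrivalRate i))
    (K := δ * L.load i) (generator_excess_le hA hB hB') (fun t => by
      rw [integral_const_mul]
      have e : L.serviceRate i * (δ * L.load i) = L.arrivalRate i * δ := by
        rw [load]; field_simp
      rw [e]
      exact mul_le_mul_of_nonneg_left (hBδ t) hl.le) t
  have h0 : classFun i (fun _ y => max ((y : ℝ) - A) 0) (L.initialState y₀) = 0 :=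
    max_eq_right (sub_nonpos.2 hy₀A)
  rw [h0] at h1
  have hint := hS.integrable_comp (hasExpGrowth_excess i hA) t
  calc ∫ ω, ((S t ω).2 i : ℝ) ∂P
      ≤ ∫ ω, (A + classFun i (fun _ y => max ((y : ℝ) - A) 0) (S t ω)) ∂P := by
        refine integral_mono (hS.integrable_comp (hasExpGrowth_snd i) t)
          ((integrable_const A).add hint) fun ω => ?_
        have := le_max_left (((S t ω).2 i : ℝ) - A) 0
        change ((S t ω).2 i : ℝ) ≤ A + max (((S t ω).2 i : ℝ) - A) 0
        linarith
    _ = A + ∫ ω, classFun i (fun _ y => max ((y : ℝ) - A) 0) (S t ω) ∂P := by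
        rw [integral_add (integrable_const A) hint]; simp
    _ ≤ _ := by linarith

/-- The expected number of class `i` requests in the augmented network, which is an `M/M/∞`
queue. -/
lemma IsStateChain.integral_classTotal [IsProbabilityMeasure P] (hS : L.IsStateChain d y₀ P ℱ S)
    (i : Fin m) (t : ℝ≥0) : ∫ ω, ((S t ω).classTotal i : ℝ) ∂P =
      L.load i + (y₀ i - L.load i) * Real.exp (-L.serviceRate i * t) := by
  have hμ := (L.serviceRate_pos i).ne'
  have hg : HasExpGrowth fun st : L.State => (st.classTotal i : ℝ) :=
    hasExpGrowth_of_le_total fun st => classTotal_le_total st i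
  have e : L.serviceRate i * L.load i = L.arrivalRate i := by rw [load]; field_simp
  have h0 : ((L.initialState y₀).classTotal i : ℝ) = y₀ i := by
    simp [initialState, State.classTotal]
  have hle := hS.integral_le_of_drift hg (hasExpGrowth_const (L.arrivalRate i))
    (K := L.load i) (fun st => (generator_classTotal d i st).le) (fun t => by simp [e]) t
  -- The drift identity is exact, so the drift inequality for the negated function gives the reverse
  -- bound.
  have hneg : ∀ st, L.generator d (fun st => -1 * (st.classTotal i : ℝ)) st =
      -L.generator d (fun st => (st.classTotal i : ℝ)) st := by
    intro st
    simp only [LossNetwork.generator, neg_add, ← Finset.sum_neg_distrib]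
    congr 1
    · congr 1
      · exact Finset.sum_congr rfl fun i _ => by ring
      · exact Finset.sum_congr rfl fun i _ => Finset.sum_congr rfl fun j _ => by ring
    · exact Finset.sum_congr rfl fun i _ => by ring
  have hge := hS.integral_le_of_drift (hg.const_mul (-1)) (hasExpGrowth_const (-L.arrivalRate i))
    (K := -L.load i) (a := L.serviceRate i)
    (fun st => by rw [hneg, generator_classTotal]; linarith) (fun t => by simp [e]) t
  rw [integral_const_mul, h0] at hge
  rw [h0] at hle
  linarith

end Expectation

/-! ### The overflow estimate for the fictitious system. -/

section Overflow

variable {ε β : ℝ} {α : L.Fractions} {d : L.Rule} {y₀ : Fin m → ℕ} {Ω : Type*}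
  [mΩ : MeasurableSpace Ω] {P : Measure Ω} {ℱ : Filtration ℝ≥0 mΩ} {S : ℝ≥0 → Ω → L.State}

/-- The level that the fictitious system rarely exceeds. -/
def fictLevel (L : LossNetwork m s) (ε : ℝ) (α : L.Fractions) (β : ℝ) (i : Fin m) : ℝ :=
  L.fictCapacity ε α i * (Real.log (s + 1) / β + 1 - ε / 2)

lemma log_succ_nonneg (s : ℕ) : 0 ≤ Real.log (s + 1) :=
  Real.log_nonneg (by linarith [(Nat.cast_nonneg s : (0 : ℝ) ≤ s)])

lemma IsTarget.le_fictLevel (T : L.IsTarget ε α β) (i : Fin m) :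
    (1 - accFrac α i) * L.load i ≤ L.fictLevel ε α β i := by
  have hε := T.eps_pos
  have h1 : 0 ≤ (1 - accFrac α i) * L.load i :=
    mul_nonneg (sub_nonneg.2 (T.feasible.accFrac_le_one i)) (L.load_pos i).le
  have h2 : 0 ≤ Real.log (s + 1) / β := div_nonneg (log_succ_nonneg s) T.beta_pos.le
  have h3 : 1 ≤ (1 + 4 * ε) * (Real.log (s + 1) / β + 1 - ε / 2) := by
    nlinarith [mul_nonneg hε.le h2, mul_pos hε (sub_pos.2 T.eps_lt)]
  have h4 := mul_le_mul_of_nonneg_left h3 h1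
  rw [fictLevel, fictCapacity_eq]
  linarith

/-- A request that is sent to the fictitious system at a high level has met either an expensive
or a crowded network. -/
lemma IsTarget.one_le_of_reject (T : L.IsTarget ε α β) (hd : L.IsPenaltyRule ε α β d) {i : Fin m}
    (hi : 0 < accFrac α i) {st : L.State} (hst : d i st = none)
    (hA : L.fictLevel ε α β i < st.2 i + 1) :
    1 ≤ (if s = 0 then 0 else 2 * Real.exp (ε - β * (1 - ε / 2)) / (s + 1)) *
        classFun i (L.mixed ε α β i) st + Real.exp (ε - β) * L.usagePenalty ε α β st := by
  have hG := mixed_pos ε α β i (st.1 i) (st.2 i)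
  have hu := T.usagePenalty_nonneg st
  have hs1 : (0 : ℝ) < s + 1 := by positivity
  by_cases hc : L.CondAccepted ε α β st i
  · obtain ⟨j, -, hj⟩ := hd.reject i st hst hc
    have h1 := T.one_le_of_not_fits hj
    have h2 : 0 ≤ (if s = 0 then 0 else 2 * Real.exp (ε - β * (1 - ε / 2)) / ((s : ℝ) + 1)) *
        classFun i (L.mixed ε α β i) st := by
      refine mul_nonneg ?_ hG.le
      split_ifs <;> positivity
    linarith
  · obtain ⟨hc0, hs, hY⟩ := T.exp_le_of_not_condAccepted hi hc
    rw [if_neg hs]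
    have hfw := T.fictWeight_nonneg i
    -- `w · fictLevel` is `β(1-ε/2) + log(s+1)`; being one short of the level costs `w ≤ ε`.
    have h1 : β * (1 - ε / 2) + Real.log (s + 1) - ε ≤ L.fictWeight ε α β i * st.2 i := by
      have e : L.fictWeight ε α β i * L.fictLevel ε α β i =
          β * (1 - ε / 2) + Real.log (s + 1) := by
        have hβ := T.beta_pos.ne'
        rw [fictWeight, fictLevel]
        field_simp
        ring
      have h2 := mul_le_mul_of_nonneg_left hA.le hfw
      rw [e] at h2
      linarith [T.fictWeight_le i]
    have h2 := (Real.exp_le_exp.2 h1).trans hY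
    have h3 : Real.exp (β * (1 - ε / 2) + Real.log (s + 1) - ε) =
        (s + 1) / Real.exp (ε - β * (1 - ε / 2)) := by
      rw [eq_div_iff (Real.exp_pos _).ne', ← Real.exp_add]
      conv_rhs => rw [← Real.exp_log hs1]
      congr 1; ring
    rw [h3, div_le_iff₀ (Real.exp_pos _)] at h2
    have h4 : 1 ≤ 2 * Real.exp (ε - β * (1 - ε / 2)) / (s + 1) *
        classFun i (L.mixed ε α β i) st := by
      rw [div_mul_eq_mul_div, le_div_iff₀ hs1, one_mul]
      change _ ≤ _ * L.mixed ε α β i (st.1 i) (st.2 i)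
      linarith
    have h5 := mul_nonneg (Real.exp_pos (ε - β)).le hu
    linarith

/-- With `e = e^ε` and `E = e^{-εβ/2}` the right side is `δ = (s+1)² e² E`, and the two terms are
`2eE` and `2s(s+1)eE²`. In the second, `s(s+1)eE ≤ δ ≤ 1` absorbs a factor; the sum is at most `4e²E
≤ δ` for `s ≥ 1`. For `s = 0` refusal is impossible, so the first coefficient may be set to `0`, and
it has to be: `2eE` need not be below `δ`. -/
lemma overflow_bound_le {ε β : ℝ} (hε : 0 < ε) (s : ℕ)
    (hδ : (s + 1 : ℝ) ^ 2 * Real.exp (-(ε / 2) * (β - 4)) ≤ 1) :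
    (if s = 0 then 0 else 2 * Real.exp (ε - β * (1 - ε / 2)) / ((s : ℝ) + 1)) *
        ((s + 1) * Real.exp (β * (1 - ε))) +
      Real.exp (ε - β) * (s * (2 * ((s + 1) * Real.exp (β * (1 - ε))))) ≤
    (s + 1 : ℝ) ^ 2 * Real.exp (-(ε / 2) * (β - 4)) := by
  rcases Nat.eq_zero_or_pos s with rfl | hs
  · simp; positivity
  have hs1 : (1 : ℝ) ≤ s := by exact_mod_cast hs
  rw [if_neg hs.ne']
  set e := Real.exp ε with he
  set E := Real.exp (-(ε / 2 * β)) with hE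
  have he1 : 1 ≤ e := Real.one_le_exp hε.le
  have hE0 : 0 < E := Real.exp_pos _
  have h1 : Real.exp (-(ε / 2) * (β - 4)) = e ^ 2 * E := by
    rw [he, hE, ← Real.exp_nat_mul, ← Real.exp_add]; congr 1; push_cast; ring
  have h2 : Real.exp (ε - β * (1 - ε / 2)) * Real.exp (β * (1 - ε)) = e * E := by
    rw [he, hE, ← Real.exp_add, ← Real.exp_add]; congr 1; ring
  have h3 : Real.exp (ε - β) * Real.exp (β * (1 - ε)) = e * E ^ 2 := by
    rw [he, hE, ← Real.exp_nat_mul, ← Real.exp_add, ← Real.exp_add]; congr 1; push_cast; ring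
  rw [h1] at hδ ⊢
  have e1 : 2 * Real.exp (ε - β * (1 - ε / 2)) / ((s : ℝ) + 1) *
      ((s + 1) * Real.exp (β * (1 - ε))) = 2 * (e * E) := by
    rw [← h2]; field_simp
  have e2 : Real.exp (ε - β) * (s * (2 * ((s + 1) * Real.exp (β * (1 - ε))))) =
      2 * (s * (s + 1)) * (e * E ^ 2) := by rw [← h3]; ring
  rw [e1, e2]
  have b1 : e * E ≤ e ^ 2 * E := by nlinarith [mul_pos (by linarith : 0 < e) hE0]
  have b2 : (s : ℝ) * (s + 1) * (e * E ^ 2) ≤ e ^ 2 * E := by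
    have : (s : ℝ) * (s + 1) * (e * E) ≤ (s + 1) ^ 2 * (e ^ 2 * E) :=
      mul_le_mul (by nlinarith) b1 (by positivity) (by positivity)
    calc (s : ℝ) * (s + 1) * (e * E ^ 2) = ((s : ℝ) * (s + 1) * (e * E)) * E := by ring
      _ ≤ 1 * E := mul_le_mul_of_nonneg_right (this.trans hδ) hE0.le
      _ ≤ e ^ 2 * E := mul_le_mul_of_nonneg_right (one_le_pow₀ he1) hE0.le
  have b3 : 4 * (e ^ 2 * E) ≤ (s + 1 : ℝ) ^ 2 * (e ^ 2 * E) :=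
    mul_le_mul_of_nonneg_right (by nlinarith) (by positivity)
  linarith

/-- The fictitious system holds few requests on average. -/
lemma IsTarget.integral_snd_le [IsProbabilityMeasure P] (T : L.IsTarget ε α β)
    (hd : L.IsPenaltyRule ε α β d) (hS : L.IsStateChain d y₀ P ℱ S)
    (hy₀ : ∀ i, (y₀ i : ℝ) = (1 - ∑ j, α i j) * L.load i) (i : Fin m) (t : ℝ≥0) :
    ∫ ω, ((S t ω).2 i : ℝ) ∂P ≤ L.fictLevel ε α β i +
      (s + 1) ^ 2 * Real.exp (-(ε / 2) * (β - 4)) *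
        (L.load i * (1 - Real.exp (-L.serviceRate i * t))) := by
  set δ := (s + 1 : ℝ) ^ 2 * Real.exp (-(ε / 2) * (β - 4)) with hδ
  have hδ0 : 0 < δ := by positivity
  have hy : (y₀ i : ℝ) = (1 - accFrac α i) * L.load i := hy₀ i
  have hyA : (y₀ i : ℝ) ≤ L.fictLevel ε α β i := hy ▸ T.le_fictLevel i
  -- If `a ≤ δ`, comparison with the total is enough, as its mean is `(1-a)ρ + aρ(1 - e^{-μt})`.
  -- Otherwise `0 < δ < a ≤ 1`, which supplies the two conditions of the overflow estimate.
  by_cases hcase : accFrac α i ≤ δ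
  · have h1 := hS.integral_classTotal i t
    have h2 : ∫ ω, ((S t ω).2 i : ℝ) ∂P ≤ ∫ ω, ((S t ω).classTotal i : ℝ) ∂P :=
      integral_mono (hS.integrable_comp (hasExpGrowth_snd i) t)
        (hS.integrable_comp (f := fun st => (st.classTotal i : ℝ))
          (hasExpGrowth_of_le_total fun st => classTotal_le_total st i) t)
        fun ω => Nat.cast_le.2 (le_classTotal_snd _ i)
    have h3 : 0 ≤ L.load i * (1 - Real.exp (-L.serviceRate i * t)) := by
      refine mul_nonneg (L.load_pos i).le (sub_nonneg.2 (Real.exp_le_one_iff.2 ?_))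
      have := mul_nonneg (L.serviceRate_pos i).le t.coe_nonneg
      linarith
    have h4 := mul_le_mul_of_nonneg_right hcase h3
    have h5 := T.le_fictLevel i
    rw [hy] at h1
    linarith
  · rw [not_le] at hcase
    have hi : 0 < accFrac α i := hδ0.trans hcase
    have hδ1 : δ ≤ 1 := hcase.le.trans (T.feasible.accFrac_le_one i)
    set K : ℝ := if s = 0 then 0 else 2 * Real.exp (ε - β * (1 - ε / 2)) / ((s : ℝ) + 1) with hK
    have hK0 : 0 ≤ K := by rw [hK]; split_ifs <;> positivity
    have hg1 := (T.hasExpGrowth_mixed i).const_mul K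
    have hg2 := (hasExpGrowth_usagePenalty ε α β).const_mul (Real.exp (ε - β))
    refine hS.integral_snd_le ((Nat.cast_nonneg _).trans hyA) hyA (hg1.add hg2)
      (fun st => add_nonneg (mul_nonneg hK0 (mixed_pos ε α β i _ _).le)
        (mul_nonneg (Real.exp_pos _).le (T.usagePenalty_nonneg st)))
      (fun st => T.one_le_of_reject hd hi) (fun t => ?_) t
    rw [integral_add (hS.integrable_comp hg1 t) (hS.integrable_comp hg2 t),
      integral_const_mul, integral_const_mul]
    refine le_trans (add_le_add (mul_le_mul_of_nonneg_left
      ((T.integral_mixed_le hd hS hy t).trans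
        (mixedBound_le s ε β (T.feasible.accFrac_le_one i))) hK0)
      (mul_le_mul_of_nonneg_left (T.integral_usagePenalty_le hd hS hy₀ t)
        (Real.exp_pos _).le)) ?_
    exact overflow_bound_le T.eps_pos s hδ1

end Overflow

lemma hasExpGrowth_rewardRate (L : LossNetwork m s) : HasExpGrowth L.rewardRate :=
  HasExpGrowth.sum _ fun i _ => (HasExpGrowth.sum _ fun j _ => hasExpGrowth_fst i j).const_mul _

end LossNetwork

end

theorem theorem7 {m s : ℕ} (L : LossNetwork m s) (ε β : ℝ) (hε : 0 < ε) (hε' : ε < 1 / 4)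
    (α : L.Fractions) (hα : L.IsOptimal ε α)
    (hβ : 0 < β) (hβ' : L.IsAdmissible ε α β)
    (y₀ : Fin m → ℕ) (hy₀ : ∀ i, (y₀ i : ℝ) = (1 - ∑ j, α i j) * L.load i)
    (d : L.Rule) (hd : L.IsPenaltyRule ε α β d)
    {Ω : Type*} [mΩ : MeasurableSpace Ω] (P : Measure Ω) [IsProbabilityMeasure P]
    (ℱ : Filtration ℝ≥0 mΩ) (S : ℝ≥0 → Ω → L.State) (hS : L.IsStateChain d y₀ P ℱ S)
    (ζ : ℝ) (hζ : ζ = (Real.log (s + 1) / β + 1 - ε / 2) * (1 + 4 * ε) - 1) (t : ℝ≥0) :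
    Integrable (fun ω => L.rewardRate (S t ω)) P ∧
    ∑ i, (∑ j, α i j) * L.reward i * L.load i * (1 - Real.exp (-L.serviceRate i * t))
      - ζ * ∑ i, (1 - ∑ j, α i j) * L.reward i * L.load i
      - (s + 1) ^ 2 * Real.exp (-(ε / 2) * (β - 4)) *
          ∑ i, L.reward i * L.load i * (1 - Real.exp (-L.serviceRate i * t))
      ≤ ∫ ω, L.rewardRate (S t ω) ∂P := by
  have T : L.IsTarget ε α β := ⟨hα.1, hβ', hε, hε', hβ⟩
  refine ⟨hS.integrable_comp L.hasExpGrowth_rewardRate t, ?_⟩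
  have hz : ∀ i, Integrable (fun ω => ((S t ω).classTotal i : ℝ)) P := fun i =>
    hS.integrable_comp (f := fun st => (st.classTotal i : ℝ))
      (LossNetwork.hasExpGrowth_of_le_total
        fun st => LossNetwork.classTotal_le_total st i) t
  have hy : ∀ i, Integrable (fun ω => ((S t ω).2 i : ℝ)) P := fun i =>
    hS.integrable_comp (LossNetwork.hasExpGrowth_snd i) t
  have hR : ∫ ω, L.rewardRate (S t ω) ∂P = ∑ i, L.reward i *
      (∫ ω, ((S t ω).classTotal i : ℝ) ∂P - ∫ ω, ((S t ω).2 i : ℝ) ∂P) := by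
    have h : ∀ ω, L.rewardRate (S t ω) =
        ∑ i, L.reward i * (((S t ω).classTotal i : ℝ) - (S t ω).2 i) := fun ω => by
      simp [LossNetwork.rewardRate, LossNetwork.State.classTotal]
    simp_rw [h]
    have hi : ∀ i, Integrable (fun ω => L.reward i * (((S t ω).classTotal i : ℝ) - (S t ω).2 i)) P :=
      fun i => ((hz i).sub (hy i)).const_mul _
    rw [integral_finsetSum _ fun i _ => hi i]
    refine Finset.sum_congr rfl fun i _ => ?_
    rw [integral_const_mul, integral_sub (hz i) (hy i)]
  rw [hR, Finset.mul_sum, Finset.mul_sum, ← Finset.sum_sub_distrib, ← Finset.sum_sub_distrib]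
  refine Finset.sum_le_sum fun i _ => ?_
  have h1 := T.integral_snd_le hd hS hy₀ i t
  have h2 := mul_le_mul_of_nonneg_left h1 (L.reward_nonneg i)
  rw [hS.integral_classTotal i t, hy₀ i, mul_sub (L.reward i) _ (∫ ω, ((S t ω).2 i : ℝ) ∂P)]
  -- This is where `ζ` comes from: the level exceeds the planned content `(1-α_i)ρ_i` by the factor
  -- `1 + ζ`. The summand `1` cancels against the mean of the total.
  have h3 : L.fictLevel ε α β i = (1 + ζ) * ((1 - ∑ j, α i j) * L.load i) := by
    rw [LossNetwork.fictLevel, LossNetwork.fictCapacity, hζ]; ring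
  rw [h3] at h2
  refine le_trans (le_of_eq ?_) (sub_le_sub_left h2 _)
  ring
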